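/- Let $m\ge 0$ and let $S\subset\mathbb R^m\otimes\mathbb R^3$ be open, with coordinates $\vec x^{\,I}=(x^I_1,x^I_2,x^I_3)$, $I=1,\dots,m$; put $x^I=x^I_1$ and $z^I=\frac12(x^I_2+i\,x^I_3)$, so that $\partial_{z^I}=\partial_{x^I_2}-i\,\partial_{x^I_3}$ and $\partial_{\bar z^I}=\partial_{x^I_2}+i\,\partial_{x^I_3}$. Summation over repeated indices is understood. Let $L:S\to\mathbb R$ be a smooth function with $$L_{x^Ix^J}=-L_{z^I\bar z^J},\qquad L_{x^Iz^J}=L_{x^Jz^I}\qquad\text{for all } I,J,$$ and such that the matrix $U_{IJ}=-\tfrac12 L_{x^Ix^J}$ is invertible at every point of $S$. The extended Gibbons–Hawking hyperkähler space with potential $L$ is the $\mathbb R^m$-bundle $N=S\times\mathbb R^m$ with fibre coordinates $\psi_I$ and connection 1-forms $A_I=\operatorname{Im}(L_{x^Iz^J}\,dz^J)+\alpha_I$, where the $\alpha_I$ are arbitrary smooth closed 1-forms on $S$ (locally $\alpha_I=d\phi_I$), carrying the hyperkähler symplectic forms and the (possibly indefinite) metric $$\Omega_i=-\tfrac12 U_{IJ}\,\varepsilon_{ijk}\,dx^I_j\wedge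 dx^J_k-dx^K_i\wedge(d\psi_K+A_K),$$ $$G(v,w)=U_{IJ}\,d\vec x^{\,I}(v)\cdot d\vec x^{\,J}(w)+U^{IJ}(d\psi_I+A_I)(v)\,(d\psi_J+A_J)(w),$$ where $U^{IJ}$ is the inverse matrix of $U_{IJ}$ and $\beta\wedge\gamma=\beta\otimes\gamma-\gamma\otimes\beta$. The collective $\mathbb H^\times/\mathbb Z_2$-action on $S$ is the (infinitesimal) action generated by $L_0=\vec x^{\,K}\cdot\vec\partial_K$ and $\vec L=(L_1,L_2,L_3)=-\vec x^{\,K}\times\vec\partial_K$, which satisfy $[L_i,L_j]=\varepsilon_{ijk}L_k$ and $[L_i,L_0]=0$. It is said to lift to a hyperkähler cone structure on $N$ if there are smooth vector fields $X,X_1,X_2,X_3$ on $N$ such that - $X$ is homothetic Euler, i.e. $\nabla_YX=Y$ for all $Y$, where $\nabla$ is the Levi-Civita connection of $G$; - $X_1,X_2,X_3$ are the other canonical vector fields of the cone, i.e. $\iota_{X_i}\Omega_i=-\iota_XG$ for $i=1,2,3$ (no sum); - $[X_i,X_j]=2\varepsilon_{ijk}X_k$ and $[X_i,X]=0$; - $X$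 and $X_i$ project to the correspondingly normalised generators $2L_0$ and $2L_i$ on $S$. **Proposition 5.1.** The collective $\mathbb H^\times/\mathbb Z_2$-action on $S$ lifts to a hyperkähler cone structure on $N$ if and only if $$L_1(L)+i\,(L_0(L)-L)\;\in\;\bigcap_{I,J}\bigl[\ker(\partial_{x^I}\partial_{x^J})\cap\ker(\partial_{z^I}\partial_{x^J})\bigr],$$ that is, all these second derivatives of the function $L_1(L)+i(L_0(L)-L)$ vanish on $S$. In particular, the action lifts to a hyperkähler cone structure if $L_1(L)=0$ and $L_0(L)=L$ on $S$. -/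

import Mathlib

open scoped ContDiff

noncomputable section

namespace LegendreHKC

/-! ### The base `ℝ^m ⊗ ℝ^3` and the total space of the (trivialised) `ℝ^m`-bundle over it.
The three directions of `ℝ^3` are numbered `0, 1, 2`, so that `p I 0`, `p I 1`, `p I 2` are the
coordinates usually written `x^I_1`, `x^I_2`, `x^I_3`. -/

/-- `ℝ^m ⊗ ℝ^3`: configurations of `m` vectors of `ℝ^3`. -/
abbrev Base (m : ℕ) : Type := Fin m → Fin 3 → ℝ

/-- Coordinates `(x, ψ)` on the total space, with fibre coordinates `ψ_I`. -/
abbrev Tot (m : ℕ) : Type := Base m × (Fin m → ℝ)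

/-- The total space `N` of the `ℝ^m`-bundle over `S`, as an open subset of `Tot m`. -/
def totalSpace {m : ℕ} (S : Set (Base m)) : Set (Tot m) := S ×ˢ Set.univ

/-- The Levi-Civita symbol `ε_{ijk}`. -/
def eps (i j k : Fin 3) : ℝ := crossProduct (Pi.single i (1 : ℝ)) (Pi.single j (1 : ℝ)) k

/-! ### Derivatives in the variables `x^I = x^I_1`, `z^I = (x^I_2 + i x^I_3)/2` -/

/-- The partial derivative `∂/∂x^I_i` of a complex-valued function. -/
def pd {m : ℕ} (I : Fin m) (i : Fin 3) (f : Base m → ℂ) (p : Base m) : ℂ :=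
  fderiv ℝ f p (Pi.single I (Pi.single i (1 : ℝ)))

/-- `∂_{x^I}`. -/
def dX {m : ℕ} (I : Fin m) (f : Base m → ℂ) (p : Base m) : ℂ := pd I 0 f p

/-- `∂_{z^I}`. As `x^I_2 = z + z̄` and `x^I_3 = -i (z - z̄)`, this is `∂_{x^I_2} - i ∂_{x^I_3}`. -/
def dZ {m : ℕ} (I : Fin m) (f : Base m → ℂ) (p : Base m) : ℂ :=
  pd I 1 f p - Complex.I * pd I 2 f p

/-- `∂_{z̄^I} = ∂_{x^I_2} + i ∂_{x^I_3}`. -/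
def dZbar {m : ℕ} (I : Fin m) (f : Base m → ℂ) (p : Base m) : ℂ :=
  pd I 1 f p + Complex.I * pd I 2 f p

/-- The complex 1-form `dz^I = (dx^I_2 + i dx^I_3)/2`. -/
def dzForm {m : ℕ} (I : Fin m) (v : Base m) : ℂ :=
  (1 / 2 : ℂ) * ((v I 1 : ℂ) + Complex.I * (v I 2 : ℂ))

/-- A real function regarded as a complex-valued one. -/
def cplx {m : ℕ} (L : Base m → ℝ) : Base m → ℂ := fun p => (L p : ℂ)

/-- The differential constraints `L_{x^I x^J} = - L_{z^I z̄^J}`, `L_{x^I z^J} = L_{x^J z^I}`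
on `S`. -/
def LegendreConstraints {m : ℕ} (S : Set (Base m)) (L : Base m → ℝ) : Prop :=
  ∀ p ∈ S, ∀ I J : Fin m,
    dX I (dX J (cplx L)) p = - dZ I (dZbar J (cplx L)) p ∧
    dX I (dZ J (cplx L)) p = dX J (dZ I (cplx L)) p

/-! ### The extended Gibbons-Hawking space with potential `L` -/

/-- The Higgs field `U_{IJ} = - L_{x^I x^J} / 2`. -/
def higgs {m : ℕ} (L : Base m → ℝ) (p : Base m) : Matrix (Fin m) (Fin m) ℝ :=
  Matrix.of fun I J => - (1 / 2) * (dX I (dX J (cplx L)) p).re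

/-- The connection 1-forms `A_I = Im (L_{x^I z^J} dz^J) + α_I`. Here `α_I` is a closed 1-form on
the base, that is, locally the differential `dφ_I` of a real shift. -/
def connForm {m : ℕ} (L : Base m → ℝ) (α : Fin m → Base m → (Base m →L[ℝ] ℝ))
    (I : Fin m) (p v : Base m) : ℝ :=
  (∑ J, dX I (dZ J (cplx L)) p * dzForm J v).im + α I p v

/-- A 1-form on an open set `S` is closed. -/
def IsClosedForm {m : ℕ} (S : Set (Base m)) (β : Base m → (Base m →L[ℝ] ℝ)) : Prop :=
  ∀ p ∈ S, ∀ v w : Base m, fderiv ℝ β p v w = fderiv ℝ β p w v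

/-- The 1-forms `dψ_I + A_I` on the total space. -/
def theta {m : ℕ} (L : Base m → ℝ) (α : Fin m → Base m → (Base m →L[ℝ] ℝ))
    (I : Fin m) (q v : Tot m) : ℝ :=
  v.2 I + connForm L α I q.1 v.1

/-- The hyperkähler symplectic forms
`Ω_i = - (1/2) U_{IJ} (dx^I ∧ dx^J)_i - dx^K_i ∧ (dψ_K + A_K)`,
where `(dx^I ∧ dx^J)_i = ε_{ijk} dx^I_j ∧ dx^J_k` and `β ∧ γ = β ⊗ γ - γ ⊗ β`. -/
def Omega {m : ℕ} (L : Base m → ℝ) (α : Fin m → Base m → (Base m →L[ℝ] ℝ))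
    (i : Fin 3) (q v w : Tot m) : ℝ :=
  - (1 / 2) * ∑ I, ∑ J, higgs L q.1 I J *
      ∑ j, ∑ k, eps i j k * (v.1 I j * w.1 J k - w.1 I j * v.1 J k)
  - ∑ K, (v.1 K i * theta L α K q w - w.1 K i * theta L α K q v)

/-- The hyperkähler metric
`G = (1/2) U_{IJ} dx^I · dx^J + (1/2) U^{IJ} (dψ_I + A_I) (dψ_J + A_J)`, with `U^{IJ}` the inverse
matrix. The product of 1-forms is `β γ = β ⊗ γ + γ ⊗ β`, matching the convention for the wedge
product; with this normalisation `Ω_i(v, w) = G(v, I_i w)`. -/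
def metricG {m : ℕ} (L : Base m → ℝ) (α : Fin m → Base m → (Base m →L[ℝ] ℝ))
    (q v w : Tot m) : ℝ :=
  (∑ I, ∑ J, higgs L q.1 I J * ∑ i, v.1 I i * w.1 J i)
  + ∑ I, ∑ J, (higgs L q.1)⁻¹ I J * (theta L α I q v * theta L α J q w)

/-! ### Hyperkähler cones -/

section Cone

variable {E : Type*} [NormedAddCommGroup E] [NormedSpace ℝ E]

/-- `g(∇_Y X, Z)` at the point `p`, for the Levi-Civita connection `∇` of the (possibly indefinite)
metric `g`, as given by the Koszul formula. -/
def leviCivita (g : E → E → E → ℝ) (Y X Z : E → E) (p : E) : ℝ :=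
  (1 / 2) * (fderiv ℝ (fun q => g q (X q) (Z q)) p (Y p)
    + fderiv ℝ (fun q => g q (Y q) (Z q)) p (X p)
    - fderiv ℝ (fun q => g q (X q) (Y q)) p (Z p)
    + g p (VectorField.lieBracket ℝ Y X p) (Z p)
    - g p (VectorField.lieBracket ℝ Y Z p) (X p)
    - g p (VectorField.lieBracket ℝ X Z p) (Y p))

/-- `X` is homothetic Euler on the open set `N`: `∇_Y X = Y` for all `Y`. Both sides are
tensorial in `Y`, so constant `Y` (and constant test vectors `Z`) suffice. -/
def IsHomotheticEuler (N : Set E) (g : E → E → E → ℝ) (X : E → E) : Prop :=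
  ∀ p ∈ N, ∀ y z : E, leviCivita g (fun _ => y) X (fun _ => z) p = g p y z

/-- The vector fields `X` and `X_1, X_2, X_3` form a hyperkähler cone structure on the open set `N`
with hyperkähler metric `g` and hyperkähler symplectic forms `Om_1, Om_2, Om_3`: the field `X` is
homothetic Euler, and the three remaining canonical vector fields are determined by it through
`ι_{X_i} Om_i = - ι_X g` (no sum), i.e. `X_i = - I_i X`. -/
structure IsHKConeStructure (N : Set E) (g : E → E → E → ℝ) (Om : Fin 3 → E → E → E → ℝ)
    (X : E → E) (Xi : Fin 3 → E → E) : Prop where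
  smooth_euler : ContDiffOn ℝ ∞ X N
  smooth_rot : ∀ i, ContDiffOn ℝ ∞ (Xi i) N
  euler : IsHomotheticEuler N g X
  canonical : ∀ i, ∀ p ∈ N, ∀ v : E, Om i p (Xi i p) v = - g p (X p) v

end Cone

/-! ### The collective action -/

/-- The generator `L_0 = x^K · ∂_K` of simultaneous scalings. -/
def scaleField {m : ℕ} (p : Base m) : Base m := p

/-- The generators `L_i = - (x^K × ∂_K)_i = - ε_{ijk} x^K_j ∂_{x^K_k}` of rigid rotations. -/
def rotField {m : ℕ} (i : Fin 3) (p : Base m) : Base m :=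
  fun K k => - ∑ j, eps i j k * p K j

/-- The collective action of `ℍ^× / ℤ_2` on the base `S`, generated by `L_0, L_1, L_2, L_3`, lifts
to a hyperkähler cone structure on the extended Gibbons-Hawking space `N` with potential `L`:
there are a homothetic Euler field `X` and canonical fields `X_i` on `N` which satisfy the
relations `[X_i, X_j] = 2 ε_{ijk} X_k`, `[X_i, X] = 0` of the Lie algebra of `ℍ^× / ℤ_2` and which
project to the generators of the collective action. The generators are normalised by
`[L_i, L_j] = ε_{ijk} L_k`, so that the matching generators of the base action are `2 L_0`
and `2 L_i`. -/
def CollectiveActionLifts {m : ℕ} (S : Set (Base m)) (L : Base m → ℝ)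
    (α : Fin m → Base m → (Base m →L[ℝ] ℝ)) : Prop :=
  ∃ (X : Tot m → Tot m) (Xi : Fin 3 → Tot m → Tot m),
    IsHKConeStructure (totalSpace S) (metricG L α) (Omega L α) X Xi ∧
    (∀ q ∈ totalSpace S, (X q).1 = (2 : ℝ) • scaleField q.1) ∧
    (∀ i, ∀ q ∈ totalSpace S, (Xi i q).1 = (2 : ℝ) • rotField i q.1) ∧
    (∀ i j, ∀ q ∈ totalSpace S,
      VectorField.lieBracket ℝ (Xi i) (Xi j) q = ∑ k, (2 * eps i j k) • Xi k q) ∧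
    (∀ i, ∀ q ∈ totalSpace S, VectorField.lieBracket ℝ (Xi i) X q = 0)

/-- `L_0(L)`. -/
def scaleDeriv {m : ℕ} (L : Base m → ℝ) (p : Base m) : ℝ := fderiv ℝ L p (scaleField p)

/-- `L_i(L)`; the direction of the `𝐢`-axis, called `L_1(L)`, is `i = 0`. -/
def rotDeriv {m : ℕ} (i : Fin 3) (L : Base m → ℝ) (p : Base m) : ℝ :=
  fderiv ℝ L p (rotField i p)

/-- The function `L_1(L) + i (L_0(L) - L)`. -/
def coneDefect {m : ℕ} (L : Base m → ℝ) (p : Base m) : ℂ :=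
  (rotDeriv 0 L p : ℂ) + Complex.I * ((scaleDeriv L p - L p : ℝ) : ℂ)

end LegendreHKC

end

noncomputable section

namespace LegendreHKC

variable {m : ℕ}

/-! Both sides of the equivalence are compared with one condition on the Higgs field alone,
`IsConical`: `U` is homogeneous of degree -1 under scalings and invariant under rotations.

The constraints on `L` say that its Hessian is symmetric in the vector indices and trace-free. Hence
its third derivative is symmetric separately in the labels I, J, K and in the vector indices. This
gives the monopole equations (`isMonopole_higgs`), after which the geometry involves only `U` and
the connection `A`. It also lets the second derivatives of the cone defect be rewritten as the
scaling and rotation derivatives of `U` (`isConical_higgs_iff`).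

On the geometric side, pairing `ι_{X_i} Ω_i = -ι_X G` with vertical vectors forces `X` to be the
horizontal lift of twice the scaling field (`eq_lift_of_canonical`). The condition `∇X = id` means
that the 1-form dual to `X` is closed and that `G` scales with weight 2 along `X`;
`leviCivita_eulerLift` writes both out. The mixed horizontal-vertical part says that the curvature
contracted with the position vector vanishes, which by the monopole equations is rotation invariance
of `U`; the horizontal part gives homogeneity. Conversely, if `U` is conical, the explicit fields
`eulerLift` and `rotLift` satisfy every requirement (`collectiveActionLifts_iff`). -/

/-! ### Coordinates, the Levi-Civita symbol and the rotation generators. -/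

/-- The coordinate vector `∂/∂x^I_i`. -/
def coordVec (I : Fin m) (i : Fin 3) : Base m := Pi.single I (Pi.single i (1 : ℝ))

lemma coordVec_apply (I : Fin m) (i : Fin 3) (J : Fin m) (j : Fin 3) :
    coordVec I i J j = if J = I ∧ j = i then 1 else 0 := by
  unfold coordVec
  by_cases h : J = I
  · subst h
    by_cases h' : j = i
    · subst h'; simp
    · simp [h']
  · simp [h]

lemma sum_coordVec (v : Base m) : v = ∑ K, ∑ a, v K a • coordVec K a := by
  funext J j
  simp only [Finset.sum_apply, Pi.smul_apply, coordVec_apply, smul_eq_mul]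
  simp [ite_and]

lemma clm_apply_eq_sum (f : Base m →L[ℝ] ℝ) (v : Base m) :
    f v = ∑ K, ∑ a, v K a * f (coordVec K a) := by
  conv_lhs => rw [sum_coordVec v]
  simp [map_sum]

/-- A Vandermonde product: it vanishes on repeated indices and equals ±2 on permutations of 0, 1, 2,
with their sign. -/
lemma eps_eq (i j k : Fin 3) : eps i j k =
    ((j : ℕ) - (i : ℕ) : ℝ) * ((k : ℕ) - (i : ℕ)) * ((k : ℕ) - (j : ℕ)) / 2 := by
  fin_cases i <;> fin_cases j <;> fin_cases k <;>
    simp [eps, crossProduct] <;> norm_num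

/-- The linear map `p ↦ L_i(p)`. -/
def rotCLM (i : Fin 3) : Base m →L[ℝ] Base m :=
  LinearMap.toContinuousLinearMap
    { toFun := rotField i
      map_add' := fun p q => by
        funext K k
        simp [rotField, mul_add, Finset.sum_add_distrib]
        ring
      map_smul' := fun c p => by
        funext K k
        simp only [rotField, Pi.smul_apply, smul_eq_mul, RingHom.id_apply, mul_neg, Finset.mul_sum]
        congr 1
        exact Finset.sum_congr rfl fun j _ => by ring }

@[simp] lemma rotCLM_apply (i : Fin 3) (p : Base m) : rotCLM i p = rotField i p := rfl

lemma rotField_zero (p : Base m) (K : Fin m) : rotField 0 p K = ![0, p K 2, - p K 1] := by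
  funext k
  fin_cases k <;> simp [rotField, Fin.sum_univ_three, eps_eq] <;> norm_num

lemma rotField_one (p : Base m) (K : Fin m) : rotField 1 p K = ![- p K 2, 0, p K 0] := by
  funext k
  fin_cases k <;> simp [rotField, Fin.sum_univ_three, eps_eq] <;> ring

lemma rotField_two (p : Base m) (K : Fin m) : rotField 2 p K = ![p K 1, - p K 0, 0] := by
  funext k
  fin_cases k <;> simp [rotField, Fin.sum_univ_three, eps_eq] <;> norm_num

/-! ### The first three derivatives of the potential -/

section Derivatives

variable {S : Set (Base m)} {L : Base m → ℝ}

lemma contDiffOn_fderiv {F : Type*} [NormedAddCommGroup F] [NormedSpace ℝ F] {f : Base m → F}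
    (hS : IsOpen S) (hf : ContDiffOn ℝ ∞ f S) : ContDiffOn ℝ ∞ (fderiv ℝ f) S :=
  hf.fderiv_of_isOpen hS (by simp)

lemma differentiableAt_of_mem {F : Type*} [NormedAddCommGroup F] [NormedSpace ℝ F] {f : Base m → F}
    (hS : IsOpen S) (hf : ContDiffOn ℝ ∞ f S) {p : Base m} (hp : p ∈ S) : DifferentiableAt ℝ f p :=
  (hf.differentiableOn (by simp)).differentiableAt (hS.mem_nhds hp)

/-- The Hessian of `L`. -/
abbrev hess (L : Base m → ℝ) : Base m → Base m →L[ℝ] Base m →L[ℝ] ℝ := fderiv ℝ (fderiv ℝ L)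

/-- The third derivative of `L`. -/
abbrev jerk (L : Base m → ℝ) : Base m → Base m →L[ℝ] Base m →L[ℝ] Base m →L[ℝ] ℝ :=
  fderiv ℝ (hess L)

lemma fderiv_symm_of_mem {F : Type*} [NormedAddCommGroup F] [NormedSpace ℝ F] {f : Base m → F}
    (hS : IsOpen S) (hf : ContDiffOn ℝ ∞ f S) {p : Base m} (hp : p ∈ S) (u v : Base m) :
    fderiv ℝ (fderiv ℝ f) p u v = fderiv ℝ (fderiv ℝ f) p v u :=
  (((hf.contDiffAt (hS.mem_nhds hp)).isSymmSndFDerivAt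
    (by simp; exact WithTop.coe_le_coe.2 le_top)) u v)

lemma fderiv_hess_apply (hS : IsOpen S) (hL : ContDiffOn ℝ ∞ L S) {p : Base m} (hp : p ∈ S)
    (u v w : Base m) : fderiv ℝ (fun q => hess L q v w) p u = jerk L p u v w := by
  have h := (differentiableAt_of_mem hS (contDiffOn_fderiv hS (contDiffOn_fderiv hS hL)) hp)
  have h2 := ((h.hasFDerivAt.clm_apply (hasFDerivAt_const v p)).clm_apply (hasFDerivAt_const w p))
  rw [h2.fderiv]
  simp

lemma fderiv_eq_of_eqOn {F : Type*} [NormedAddCommGroup F] [NormedSpace ℝ F] {f g : Base m → F}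
    (hS : IsOpen S) (h : ∀ q ∈ S, f q = g q) {p : Base m} (hp : p ∈ S) :
    fderiv ℝ f p = fderiv ℝ g p :=
  Filter.EventuallyEq.fderiv_eq (Filter.eventually_of_mem (hS.mem_nhds hp) h)

lemma jerk_swap_left (hS : IsOpen S) (hL : ContDiffOn ℝ ∞ L S) {p : Base m} (hp : p ∈ S)
    (u v w : Base m) : jerk L p u v w = jerk L p v u w := by
  have := fderiv_symm_of_mem hS (contDiffOn_fderiv hS hL) hp u v
  exact congrArg (fun f => f w) this

lemma jerk_swap_right (hS : IsOpen S) (hL : ContDiffOn ℝ ∞ L S) {p : Base m} (hp : p ∈ S)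
    (u v w : Base m) : jerk L p u v w = jerk L p u w v := by
  rw [← fderiv_hess_apply hS hL hp, ← fderiv_hess_apply hS hL hp,
    fderiv_eq_of_eqOn hS (fun q hq => fderiv_symm_of_mem hS hL hq v w) hp]

lemma fderiv_fderiv_apply (hS : IsOpen S) (hL : ContDiffOn ℝ ∞ L S) {p : Base m} (hp : p ∈ S)
    (u v : Base m) : fderiv ℝ (fun q => fderiv ℝ L q v) p u = hess L p u v := by
  have h := (differentiableAt_of_mem hS (contDiffOn_fderiv hS hL) hp)
  rw [(h.hasFDerivAt.clm_apply (hasFDerivAt_const v p)).fderiv]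
  simp

/-- First derivative of `q ↦ dL_q(M q)`. -/
lemma fderiv_fderiv_linear (hS : IsOpen S) (hL : ContDiffOn ℝ ∞ L S) {p : Base m} (hp : p ∈ S)
    (M : Base m →L[ℝ] Base m) (v : Base m) :
    fderiv ℝ (fun q => fderiv ℝ L q (M q)) p v = hess L p v (M p) + fderiv ℝ L p (M v) := by
  have h := (differentiableAt_of_mem hS (contDiffOn_fderiv hS hL) hp)
  rw [(h.hasFDerivAt.clm_apply M.hasFDerivAt).fderiv]
  simp [add_comm]

/-- Second derivative of `q ↦ dL_q(M q)`. -/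
lemma fderiv_fderiv_fderiv_linear (hS : IsOpen S) (hL : ContDiffOn ℝ ∞ L S) {p : Base m}
    (hp : p ∈ S) (M : Base m →L[ℝ] Base m) (u v : Base m) :
    fderiv ℝ (fun q => fderiv ℝ (fun q => fderiv ℝ L q (M q)) q v) p u =
      jerk L p u v (M p) + hess L p v (M u) + hess L p u (M v) := by
  rw [fderiv_eq_of_eqOn hS (fun q hq => fderiv_fderiv_linear hS hL hq M v) hp]
  have h := (differentiableAt_of_mem hS (contDiffOn_fderiv hS hL) hp)
  have h2 := (differentiableAt_of_mem hS (contDiffOn_fderiv hS (contDiffOn_fderiv hS hL)) hp)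
  rw [(((h2.hasFDerivAt.clm_apply (hasFDerivAt_const v p)).clm_apply M.hasFDerivAt).fun_add
    (h.hasFDerivAt.clm_apply (hasFDerivAt_const (M v) p))).fderiv]
  simp
  ring

/-- The partial derivative of a complex function given by its real and imaginary parts. -/
lemma pd_eq (hS : IsOpen S) {f : Base m → ℂ} {a b : Base m → ℝ}
    (h : ∀ q ∈ S, f q = (a q : ℂ) + Complex.I * (b q : ℂ)) {p : Base m} (hp : p ∈ S)
    (ha : DifferentiableAt ℝ a p) (hb : DifferentiableAt ℝ b p) (I : Fin m) (i : Fin 3) :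
    pd I i f p = ((fderiv ℝ a p (coordVec I i) : ℝ) : ℂ)
      + Complex.I * ((fderiv ℝ b p (coordVec I i) : ℝ) : ℂ) := by
  unfold pd
  rw [fderiv_eq_of_eqOn hS h hp]
  have h1 := Complex.ofRealCLM.hasFDerivAt.comp p ha.hasFDerivAt
  have h2 := (Complex.ofRealCLM.hasFDerivAt.comp p hb.hasFDerivAt).const_mul Complex.I
  have h3 := h1.add h2
  have : (fun q => (a q : ℂ) + Complex.I * (b q : ℂ)) =
    ((Complex.ofRealCLM ∘ a) + fun y => Complex.I * (Complex.ofRealCLM ∘ b) y) := rfl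
  rw [this, h3.fderiv]
  simp [coordVec]

lemma pd_cplx (hS : IsOpen S) (hL : ContDiffOn ℝ ∞ L S) {p : Base m} (hp : p ∈ S)
    (I : Fin m) (i : Fin 3) :
    pd I i (cplx L) p = ((fderiv ℝ L p (coordVec I i) : ℝ) : ℂ) := by
  rw [pd_eq hS (a := L) (b := fun _ => 0) (fun q _ => by simp [cplx]) hp
    (differentiableAt_of_mem hS hL hp) (differentiableAt_const _)]
  simp

lemma differentiableAt_fderiv_apply (hS : IsOpen S) (hL : ContDiffOn ℝ ∞ L S) {p : Base m}
    (hp : p ∈ S) (v : Base m) : DifferentiableAt ℝ (fun q => fderiv ℝ L q v) p :=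
  (differentiableAt_of_mem hS (contDiffOn_fderiv hS hL) hp).clm_apply (differentiableAt_const v)

lemma pd_dX (hS : IsOpen S) (hL : ContDiffOn ℝ ∞ L S) {p : Base m} (hp : p ∈ S)
    (I J : Fin m) (i : Fin 3) :
    pd I i (dX J (cplx L)) p = ((hess L p (coordVec I i) (coordVec J 0) : ℝ) : ℂ) := by
  rw [pd_eq hS (a := fun q => fderiv ℝ L q (coordVec J 0)) (b := fun _ => 0) _ hp
    (differentiableAt_fderiv_apply hS hL hp _) (differentiableAt_const _),
    fderiv_fderiv_apply hS hL hp]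
  · simp
  · intro q hq
    simp [dX, pd_cplx hS hL hq]

lemma pd_dZ (hS : IsOpen S) (hL : ContDiffOn ℝ ∞ L S) {p : Base m} (hp : p ∈ S)
    (I J : Fin m) (i : Fin 3) :
    pd I i (dZ J (cplx L)) p = ((hess L p (coordVec I i) (coordVec J 1) : ℝ) : ℂ)
      - Complex.I * ((hess L p (coordVec I i) (coordVec J 2) : ℝ) : ℂ) := by
  rw [pd_eq hS (a := fun q => fderiv ℝ L q (coordVec J 1))
    (b := fun q => - fderiv ℝ L q (coordVec J 2)) _ hp
    (differentiableAt_fderiv_apply hS hL hp _) (differentiableAt_fderiv_apply hS hL hp _).fun_neg,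
    fderiv_fderiv_apply hS hL hp, fderiv_fun_neg, neg_apply,
    fderiv_fderiv_apply hS hL hp]
  · push_cast; ring
  · intro q hq
    simp only [dZ, pd_cplx hS hL hq]
    push_cast; ring

lemma pd_dZbar (hS : IsOpen S) (hL : ContDiffOn ℝ ∞ L S) {p : Base m} (hp : p ∈ S)
    (I J : Fin m) (i : Fin 3) :
    pd I i (dZbar J (cplx L)) p = ((hess L p (coordVec I i) (coordVec J 1) : ℝ) : ℂ)
      + Complex.I * ((hess L p (coordVec I i) (coordVec J 2) : ℝ) : ℂ) := by
  rw [pd_eq hS (a := fun q => fderiv ℝ L q (coordVec J 1))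
    (b := fun q => fderiv ℝ L q (coordVec J 2)) _ hp
    (differentiableAt_fderiv_apply hS hL hp _) (differentiableAt_fderiv_apply hS hL hp _),
    fderiv_fderiv_apply hS hL hp, fderiv_fderiv_apply hS hL hp]
  intro q hq
  simp only [dZbar, pd_cplx hS hL hq]

/-! ### The differential constraints -/

/-- This is the real part of the first constraint. -/
lemma hess_trace (hS : IsOpen S) (hL : ContDiffOn ℝ ∞ L S) (hc : LegendreConstraints S L)
    {p : Base m} (hp : p ∈ S) (I J : Fin m) :
    hess L p (coordVec I 0) (coordVec J 0) + hess L p (coordVec I 1) (coordVec J 1)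
      + hess L p (coordVec I 2) (coordVec J 2) = 0 := by
  have h := (hc p hp I J).1
  simp only [dX.eq_1 I, dZ.eq_1 I, pd_dX hS hL hp, pd_dZbar hS hL hp] at h
  have := congrArg Complex.re h
  simp at this
  linarith

/-- The imaginary part of the first constraint exchanges directions 1 and 2; the real and imaginary
parts of the second exchange 0 with 1 and 0 with 2. -/
lemma hess_exchange (hS : IsOpen S) (hL : ContDiffOn ℝ ∞ L S) (hc : LegendreConstraints S L)
    {p : Base m} (hp : p ∈ S) (I J : Fin m) (i j : Fin 3) :
    hess L p (coordVec I i) (coordVec J j) = hess L p (coordVec I j) (coordVec J i) := by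
  have h1 := (hc p hp I J).1
  have h2 := (hc p hp I J).2
  simp only [dX.eq_1 I, dX.eq_1 J (dZ _ _), dZ.eq_1 I (dZbar _ _), pd_dX hS hL hp,
    pd_dZbar hS hL hp, pd_dZ hS hL hp] at h1 h2
  have a1 := congrArg Complex.im h1
  have a2 := congrArg Complex.re h2
  have a3 := congrArg Complex.im h2
  simp at a1 a2 a3
  have s := fderiv_symm_of_mem hS hL hp
  rw [s (coordVec J 0)] at a2 a3
  fin_cases i <;> fin_cases j <;> simp <;> linarith

lemma jerk_trace (hS : IsOpen S) (hL : ContDiffOn ℝ ∞ L S) (hc : LegendreConstraints S L)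
    {p : Base m} (hp : p ∈ S) (u : Base m) (I J : Fin m) :
    jerk L p u (coordVec I 0) (coordVec J 0) + jerk L p u (coordVec I 1) (coordVec J 1)
      + jerk L p u (coordVec I 2) (coordVec J 2) = 0 := by
  have h := fderiv_eq_of_eqOn hS (fun q hq => hess_trace hS hL hc hq I J) hp
  have hd := fun v w => ((differentiableAt_of_mem hS
    (contDiffOn_fderiv hS (contDiffOn_fderiv hS hL)) hp).clm_apply
      (differentiableAt_const v)).clm_apply (differentiableAt_const w)
  rw [fderiv_fun_add ((hd _ _).fun_add (hd _ _)) (hd _ _), fderiv_fun_add (hd _ _) (hd _ _)] at h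
  have h' := congrArg (fun f => f u) h
  simpa [fderiv_hess_apply hS hL hp] using h'

lemma jerk_exchange (hS : IsOpen S) (hL : ContDiffOn ℝ ∞ L S) (hc : LegendreConstraints S L)
    {p : Base m} (hp : p ∈ S) (u : Base m) (I J : Fin m) (i j : Fin 3) :
    jerk L p u (coordVec I i) (coordVec J j) = jerk L p u (coordVec I j) (coordVec J i) := by
  rw [← fderiv_hess_apply hS hL hp, ← fderiv_hess_apply hS hL hp,
    fderiv_eq_of_eqOn hS (fun q hq => hess_exchange hS hL hc hq I J i j) hp]

end Derivatives


/-! ### The monopole equations for the Higgs field and the connection. -/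

/-- `U` and `A` solve the (generalised) Bogomolny monopole equations on `S`. -/
structure IsMonopole (S : Set (Base m)) (U : Base m → Matrix (Fin m) (Fin m) ℝ)
    (A : Fin m → Base m → Base m →L[ℝ] ℝ) : Prop where
  smooth_higgs : ∀ I J, ContDiffOn ℝ ∞ (fun p => U p I J) S
  smooth_potential : ∀ I, ContDiffOn ℝ ∞ (A I) S
  symm : ∀ p ∈ S, ∀ I J, U p I J = U p J I
  fderiv_symm : ∀ p ∈ S, ∀ I J K a, fderiv ℝ (fun p => U p I J) p (coordVec K a) =
    fderiv ℝ (fun p => U p K J) p (coordVec I a)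
  curvature : ∀ p ∈ S, ∀ I v w, fderiv ℝ (A I) p v w - fderiv ℝ (A I) p w v =
    ∑ K, ∑ c, w K c * fderiv ℝ (fun p => U p I K) p (rotField c v)

/-- The Higgs field is homogeneous of degree `-1` under scalings and invariant under rotations. -/
def IsConical (S : Set (Base m)) (U : Base m → Matrix (Fin m) (Fin m) ℝ) : Prop :=
  ∀ p ∈ S, ∀ I J, fderiv ℝ (fun p => U p I J) p p = - U p I J ∧
    ∀ c, fderiv ℝ (fun p => U p I J) p (rotField c p) = 0

/-- The connection 1-forms of the extended Gibbons-Hawking space as smooth sections. -/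
def gaugePotential (L : Base m → ℝ) (α : Fin m → Base m → (Base m →L[ℝ] ℝ))
    (I : Fin m) (p : Base m) : Base m →L[ℝ] ℝ :=
  (∑ J, ((1 / 2 : ℝ) * hess L p (coordVec I 0) (coordVec J 1)) •
      (ContinuousLinearMap.proj (R := ℝ) (φ := fun _ : Fin 3 => ℝ) 2).comp
        (ContinuousLinearMap.proj (R := ℝ) (φ := fun _ : Fin m => Fin 3 → ℝ) J)
    - ∑ J, ((1 / 2 : ℝ) * hess L p (coordVec I 0) (coordVec J 2)) •
      (ContinuousLinearMap.proj (R := ℝ) (φ := fun _ : Fin 3 => ℝ) 1).comp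
        (ContinuousLinearMap.proj (R := ℝ) (φ := fun _ : Fin m => Fin 3 → ℝ) J)) + α I p

section

variable {S : Set (Base m)} {L : Base m → ℝ} {α : Fin m → Base m → (Base m →L[ℝ] ℝ)}

lemma connForm_eq (hS : IsOpen S) (hL : ContDiffOn ℝ ∞ L S) {p : Base m} (hp : p ∈ S)
    (I : Fin m) (v : Base m) : connForm L α I p v = gaugePotential L α I p v := by
  simp only [connForm, gaugePotential, dX.eq_1 I, pd_dZ hS hL hp, dzForm, add_apply, sub_apply,
    sum_apply, Complex.im_sum, smul_apply, ← Finset.sum_sub_distrib]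
  congr 1
  refine Finset.sum_congr rfl fun J _ => ?_
  simp
  ring

lemma higgs_eq (hS : IsOpen S) (hL : ContDiffOn ℝ ∞ L S) {p : Base m} (hp : p ∈ S)
    (I J : Fin m) : higgs L p I J = - (1 / 2) * hess L p (coordVec I 0) (coordVec J 0) := by
  simp [higgs, dX.eq_1 I, pd_dX hS hL hp]

lemma contDiffOn_hess_apply (hS : IsOpen S) (hL : ContDiffOn ℝ ∞ L S) (u v : Base m) :
    ContDiffOn ℝ ∞ (fun p => hess L p u v) S :=
  ((contDiffOn_fderiv hS (contDiffOn_fderiv hS hL)).clm_apply contDiffOn_const).clm_apply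
    contDiffOn_const

lemma fderiv_higgs (hS : IsOpen S) (hL : ContDiffOn ℝ ∞ L S) {p : Base m} (hp : p ∈ S)
    (I J : Fin m) (v : Base m) : fderiv ℝ (fun p => higgs L p I J) p v =
      - (1 / 2) * jerk L p v (coordVec I 0) (coordVec J 0) := by
  rw [fderiv_eq_of_eqOn hS (fun q hq => higgs_eq hS hL hq I J) hp,
    fderiv_const_mul (differentiableAt_of_mem hS (contDiffOn_hess_apply hS hL _ _) hp),
    smul_apply, fderiv_hess_apply hS hL hp, smul_eq_mul]

lemma contDiffOn_gaugePotential (hS : IsOpen S) (hL : ContDiffOn ℝ ∞ L S)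
    (hα : ∀ I, ContDiffOn ℝ ∞ (α I) S) (I : Fin m) : ContDiffOn ℝ ∞ (gaugePotential L α I) S := by
  unfold gaugePotential
  refine ContDiffOn.add (ContDiffOn.sub ?_ ?_) (hα I) <;>
  exact ContDiffOn.sum fun J _ =>
    (contDiffOn_const.mul (contDiffOn_hess_apply hS hL _ _)).smul contDiffOn_const

lemma fderiv_gaugePotential (hS : IsOpen S) (hL : ContDiffOn ℝ ∞ L S)
    (hα : ∀ I, ContDiffOn ℝ ∞ (α I) S) {p : Base m} (hp : p ∈ S) (I : Fin m) (v w : Base m) :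
    fderiv ℝ (gaugePotential L α I) p v w =
      (1 / 2) * ∑ J, (jerk L p v (coordVec I 0) (coordVec J 1) * w J 2
        - jerk L p v (coordVec I 0) (coordVec J 2) * w J 1) + fderiv ℝ (α I) p v w := by
  have h1 : fderiv ℝ (gaugePotential L α I) p v w
      = fderiv ℝ (fun q => gaugePotential L α I q w) p v := by
    rw [((differentiableAt_of_mem hS (contDiffOn_gaugePotential hS hL hα I) hp).hasFDerivAt.clm_apply
      (hasFDerivAt_const w p)).fderiv]
    simp
  have h2 : (fun q => gaugePotential L α I q w) = fun q =>
      (∑ J, ((1 / 2) * w J 2 * hess L q (coordVec I 0) (coordVec J 1)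
        - (1 / 2) * w J 1 * hess L q (coordVec I 0) (coordVec J 2))) + α I q w := by
    funext q
    simp only [gaugePotential, add_apply, sub_apply, sum_apply, smul_apply,
      ← Finset.sum_sub_distrib]
    congr 1
    refine Finset.sum_congr rfl fun J _ => ?_
    simp
    ring
  have hd := fun u v => (differentiableAt_of_mem hS (contDiffOn_hess_apply hS hL u v) hp).hasFDerivAt
  rw [h1, h2, ((HasFDerivAt.fun_sum fun J _ => ((hd _ _).const_mul _).fun_sub
    ((hd _ _).const_mul _)).fun_add ((differentiableAt_of_mem hS (hα I) hp).hasFDerivAt.clm_apply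
      (hasFDerivAt_const w p))).fderiv]
  simp only [add_apply, sum_apply, sub_apply, smul_apply, fderiv_hess_apply hS hL hp,
    Finset.mul_sum]
  congr 1
  · refine Finset.sum_congr rfl fun J _ => ?_
    simp
    ring
  · simp

lemma jerk_symm (hS : IsOpen S) (hL : ContDiffOn ℝ ∞ L S) {p : Base m} (hp : p ∈ S)
    (u v w : Base m) : jerk L p u v w = jerk L p w u v := by
  rw [jerk_swap_right hS hL hp, jerk_swap_left hS hL hp]

lemma jerk_eq_sum (p u v w : Base m) :
    jerk L p u v w = ∑ K, ∑ a, u K a * jerk L p (coordVec K a) v w :=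
  clm_apply_eq_sum (((jerk L p).flip v).flip w) u

lemma jerk_exchange_left (hS : IsOpen S) (hL : ContDiffOn ℝ ∞ L S)
    (hc : LegendreConstraints S L) {p : Base m} (hp : p ∈ S) (u : Base m) (K J : Fin m)
    (a b : Fin 3) : jerk L p (coordVec K a) u (coordVec J b) =
      jerk L p (coordVec K b) u (coordVec J a) := by
  rw [jerk_swap_left hS hL hp, jerk_exchange hS hL hc hp, jerk_swap_left hS hL hp]

/-- Everything here is symmetry of third derivatives of `L`. The closed forms `α` drop out of the
curvature, and the trace condition is what remains after all exchanges have been made. -/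
theorem isMonopole_higgs (hS : IsOpen S) (hL : ContDiffOn ℝ ∞ L S)
    (hc : LegendreConstraints S L) (hα : ∀ I, ContDiffOn ℝ ∞ (α I) S)
    (hαclosed : ∀ I, IsClosedForm S (α I)) :
    IsMonopole S (higgs L) (gaugePotential L α) where
  smooth_higgs I J :=
    (contDiffOn_const.mul (contDiffOn_hess_apply hS hL _ _)).congr
      fun p hp => higgs_eq hS hL hp I J
  smooth_potential := contDiffOn_gaugePotential hS hL hα
  symm p hp I J := by
    rw [higgs_eq hS hL hp, higgs_eq hS hL hp, fderiv_symm_of_mem hS hL hp]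
  fderiv_symm p hp I J K a := by
    rw [fderiv_higgs hS hL hp, fderiv_higgs hS hL hp, jerk_symm hS hL hp (coordVec K a),
      jerk_exchange hS hL hc hp, jerk_symm hS hL hp, jerk_swap_right hS hL hp]
  curvature p hp I v w := by
    have ha : fderiv ℝ (α I) p v w = fderiv ℝ (α I) p w v := hαclosed I p hp v w
    rw [fderiv_gaugePotential hS hL hα hp, fderiv_gaugePotential hS hL hα hp, ha,
      add_sub_add_right_eq_sub]
    simp only [fderiv_higgs hS hL hp]
    have hsum : ∀ x y : Base m,
        ∑ J, (jerk L p x (coordVec I 0) (coordVec J 1) * y J 2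
          - jerk L p x (coordVec I 0) (coordVec J 2) * y J 1) =
        ∑ J, ∑ K, ∑ a, x K a * (jerk L p (coordVec K a) (coordVec I 0) (coordVec J 1) * y J 2
          - jerk L p (coordVec K a) (coordVec I 0) (coordVec J 2) * y J 1) := by
      intro x y
      refine Finset.sum_congr rfl fun J _ => ?_
      rw [jerk_eq_sum p x, jerk_eq_sum p x, Finset.sum_mul, Finset.sum_mul,
        ← Finset.sum_sub_distrib]
      refine Finset.sum_congr rfl fun K _ => ?_
      rw [Finset.sum_mul, Finset.sum_mul, ← Finset.sum_sub_distrib]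
      exact Finset.sum_congr rfl fun a _ => by ring
    have hrot : ∀ J, ∑ c, w J c * (-(1 / 2) * jerk L p (rotField c v) (coordVec I 0) (coordVec J 0))
        = ∑ K, ∑ c, w J c * (-(1 / 2) * ∑ a, rotField c v K a *
          jerk L p (coordVec K a) (coordVec I 0) (coordVec J 0)) := by
      intro J
      rw [Finset.sum_comm]
      refine Finset.sum_congr rfl fun c _ => ?_
      rw [jerk_eq_sum p (rotField c v), Finset.mul_sum, Finset.mul_sum]
    simp only [hrot]
    rw [hsum v w, hsum w v, Finset.sum_comm (f := fun J K => ∑ a, w K a * _), ← mul_sub,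
      ← Finset.sum_sub_distrib, Finset.mul_sum]
    refine Finset.sum_congr rfl fun J _ => ?_
    rw [← Finset.sum_sub_distrib, Finset.mul_sum]
    refine Finset.sum_congr rfl fun K _ => ?_
    have sw : ∀ a b, jerk L p (coordVec J a) (coordVec I 0) (coordVec K b) =
        jerk L p (coordVec K a) (coordVec I 0) (coordVec J b) := fun a b => by
      rw [jerk_swap_right hS hL hp, jerk_swap_left hS hL hp, jerk_swap_right hS hL hp,
        jerk_exchange_left hS hL hc hp]
    have ex := jerk_exchange_left hS hL hc hp (coordVec I 0) K J
    have tr := jerk_trace hS hL hc hp (coordVec I 0) K J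
    simp only [jerk_swap_left hS hL hp (coordVec I 0)] at tr
    simp only [Fin.sum_univ_three, rotField_zero, rotField_one, rotField_two, sw, ex 1 0, ex 2 0,
      ex 2 1]
    simp
    -- After the exchanges both sides differ only by a multiple of the trace over the three
    -- directions.
    linear_combination (1 / 2 * (v K 1 * w J 2 - v K 2 * w J 1)) * tr

/-! ### The cone defect and conicality of the Higgs field. -/

/-- Differentiating `dL(p)` twice produces two Hessian terms by the Leibniz rule; subtracting `L`
removes one of them. In the rotation part one Hessian term is absent because rotation about the
first axis fixes that axis (`h0`). -/
lemma pd_dX_coneDefect (hS : IsOpen S) (hL : ContDiffOn ℝ ∞ L S) {p : Base m} (hp : p ∈ S)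
    (I J : Fin m) (i : Fin 3) :
    pd I i (dX J (coneDefect L)) p =
      ((jerk L p (coordVec I i) (coordVec J 0) (rotField 0 p)
        + hess L p (coordVec J 0) (rotField 0 (coordVec I i)) : ℝ) : ℂ)
      + Complex.I * ((jerk L p (coordVec I i) (coordVec J 0) p
        + hess L p (coordVec J 0) (coordVec I i) : ℝ) : ℂ) := by
  have hs : ∀ M : Base m →L[ℝ] Base m, ContDiffOn ℝ ∞ (fun q => fderiv ℝ L q (M q)) S := fun M =>
    (contDiffOn_fderiv hS hL).clm_apply M.contDiff.contDiffOn
  have hb : ContDiffOn ℝ ∞ (fun q => fderiv ℝ L q (ContinuousLinearMap.id ℝ _ q) - L q) S :=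
    (hs _).sub hL
  have h1 : ∀ q ∈ S, dX J (coneDefect L) q =
      ((fderiv ℝ (fun q => fderiv ℝ L q (rotCLM 0 q)) q (coordVec J 0) : ℝ) : ℂ) + Complex.I *
      ((fderiv ℝ (fun q => fderiv ℝ L q (ContinuousLinearMap.id ℝ _ q) - L q) q (coordVec J 0) : ℝ)
        : ℂ) := fun q hq =>
    pd_eq hS (a := fun q => fderiv ℝ L q (rotCLM 0 q)) (fun _ _ => rfl) hq
      (differentiableAt_of_mem hS (hs _) hq) (differentiableAt_of_mem hS hb hq) _ _
  rw [pd_eq hS h1 hp (differentiableAt_fderiv_apply hS (hs _) hp _)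
    (differentiableAt_fderiv_apply hS hb hp _), fderiv_fderiv_fderiv_linear hS hL hp]
  have h2 : ∀ q ∈ S, fderiv ℝ (fun q => fderiv ℝ L q (ContinuousLinearMap.id ℝ _ q) - L q) q
      (coordVec J 0) = fderiv ℝ (fun q => fderiv ℝ L q (ContinuousLinearMap.id ℝ _ q)) q
        (coordVec J 0) - fderiv ℝ L q (coordVec J 0) := fun q hq => by
    rw [fderiv_fun_sub (differentiableAt_of_mem hS (hs _) hq) (differentiableAt_of_mem hS hL hq)]
    rfl
  rw [fderiv_eq_of_eqOn hS h2 hp, fderiv_fun_sub (differentiableAt_fderiv_apply hS (hs _) hp _)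
    (differentiableAt_fderiv_apply hS hL hp _), sub_apply, fderiv_fderiv_fderiv_linear hS hL hp,
    fderiv_fderiv_apply hS hL hp]
  have h0 : rotCLM 0 (coordVec J 0) = 0 := by
    funext K k
    rw [rotCLM_apply, rotField_zero]
    fin_cases k <;> simp [coordVec_apply]
  rw [h0, map_zero]
  simp

/-- The equations match one by one. The real and imaginary parts of the double x-derivative are
invariance under rotation 0 and homogeneity. In the mixed z-x derivative the Hessian terms cancel,
and its real and imaginary parts are invariance under rotations 1 and 2. -/
theorem isConical_higgs_iff (hS : IsOpen S) (hL : ContDiffOn ℝ ∞ L S)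
    (hc : LegendreConstraints S L) :
    IsConical S (higgs L) ↔ ∀ I J : Fin m, ∀ p ∈ S,
      dX I (dX J (coneDefect L)) p = 0 ∧ dZ I (dX J (coneDefect L)) p = 0 := by
  have hswap : IsConical S (higgs L) ↔ ∀ I J, ∀ p ∈ S,
      fderiv ℝ (fun p => higgs L p I J) p p = - higgs L p I J ∧
        ∀ c, fderiv ℝ (fun p => higgs L p I J) p (rotField c p) = 0 :=
    ⟨fun h I J p hp => h p hp I J, fun h p hp I J => h I J p hp⟩
  rw [hswap]
  refine forall₄_congr fun I J p hp => ?_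
  rw [fderiv_higgs hS hL hp, higgs_eq hS hL hp]
  simp only [fderiv_higgs hS hL hp, dX.eq_1 I, dZ.eq_1 I, pd_dX_coneDefect hS hL hp]
  have r0 : rotField 0 (coordVec I 0) = 0 := by
    funext K k
    rw [rotField_zero]
    fin_cases k <;> simp [coordVec_apply]
  have r1 : rotField 0 (coordVec I 1) = - coordVec I 2 := by
    funext K k
    rw [rotField_zero]
    fin_cases k <;> simp [coordVec_apply]
  have r2 : rotField 0 (coordVec I 2) = coordVec I 1 := by
    funext K k
    rw [rotField_zero]
    fin_cases k <;> simp [coordVec_apply]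
  have sJ := fderiv_symm_of_mem hS hL hp (coordVec J 0)
  have ex : ∀ K a b, jerk L p (coordVec K a) (coordVec I b) (coordVec J 0) =
      jerk L p (coordVec K b) (coordVec I a) (coordVec J 0) := fun K a b => by
    rw [jerk_swap_right hS hL hp, jerk_exchange_left hS hL hc hp, jerk_swap_right hS hL hp]
  have tr : ∀ K, jerk L p (coordVec K 0) (coordVec I 0) (coordVec J 0)
      + jerk L p (coordVec K 1) (coordVec I 1) (coordVec J 0)
      + jerk L p (coordVec K 2) (coordVec I 2) (coordVec J 0) = 0 := fun K => by
    rw [jerk_symm hS hL hp (coordVec K 0), jerk_symm hS hL hp (coordVec K 1),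
      jerk_symm hS hL hp (coordVec K 2), jerk_trace hS hL hc hp]
  -- Exchange cancels the off-diagonal terms in directions 1 and 2; the trace condition turns the
  -- remaining two diagonal terms into minus the third. The identity `e2` works the same way.
  have e1 : jerk L p (coordVec I 1) (coordVec J 0) (rotField 0 p)
      + jerk L p (coordVec I 2) (coordVec J 0) p =
        jerk L p (rotField 1 p) (coordVec I 0) (coordVec J 0) := by
    rw [jerk_symm hS hL hp, jerk_symm hS hL hp (coordVec I 2), jerk_eq_sum p (rotField 0 p),
      jerk_eq_sum p p, jerk_eq_sum p (rotField 1 p), ← Finset.sum_add_distrib]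
    refine Finset.sum_congr rfl fun K _ => ?_
    simp only [Fin.sum_univ_three, rotField_zero, rotField_one, ex K 2 1, ex K 0 2]
    simp
    linear_combination p K 2 * tr K
  have e2 : jerk L p (coordVec I 1) (coordVec J 0) p
      - jerk L p (coordVec I 2) (coordVec J 0) (rotField 0 p) =
        - jerk L p (rotField 2 p) (coordVec I 0) (coordVec J 0) := by
    rw [jerk_symm hS hL hp, jerk_symm hS hL hp (coordVec I 2), jerk_eq_sum p (rotField 0 p),
      jerk_eq_sum p p, jerk_eq_sum p (rotField 2 p), ← Finset.sum_sub_distrib,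
      ← Finset.sum_neg_distrib]
    refine Finset.sum_congr rfl fun K _ => ?_
    simp only [Fin.sum_univ_three, rotField_zero, rotField_two, ex K 2 1, ex K 0 1]
    simp
    linear_combination p K 1 * tr K
  have e0 : ∀ v, jerk L p (coordVec I 0) (coordVec J 0) v =
      jerk L p v (coordVec I 0) (coordVec J 0) := fun v => jerk_symm hS hL hp _ _ _
  rw [r0, r1, r2]
  simp only [Fin.forall_fin_succ, Complex.ext_iff]
  simp [e0, sJ]
  constructor
  · rintro ⟨h1, h2, h3, h4⟩
    exact ⟨⟨h2, by linarith⟩, by linarith, by linarith⟩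
  · rintro ⟨⟨h1, h2⟩, h3, h4⟩
    exact ⟨by linarith, h1, by linarith, by linarith⟩

end

/-! ### Invariant lifts to the total space and their Lie brackets. -/

section

variable {S : Set (Base m)} {U : Base m → Matrix (Fin m) (Fin m) ℝ}
  {A : Fin m → Base m → Base m →L[ℝ] ℝ}

lemma isOpen_totalSpace (hS : IsOpen S) : IsOpen (totalSpace S) := hS.prod isOpen_univ

lemma mem_totalSpace {q : Tot m} : q ∈ totalSpace S ↔ q.1 ∈ S := by simp [totalSpace]

lemma fderiv_comp_fst {F : Type*} [NormedAddCommGroup F] [NormedSpace ℝ F] {f : Base m → F}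
    {q : Tot m} (hf : DifferentiableAt ℝ f q.1) (y : Tot m) :
    fderiv ℝ (fun q : Tot m => f q.1) q y = fderiv ℝ f q.1 y.1 := by
  have h : HasFDerivAt (fun q : Tot m => f q.1) _ q := hf.hasFDerivAt.comp q hasFDerivAt_fst
  rw [h.fderiv]
  rfl

/-- The invariant vector field on the total space which covers the linear vector field `M` and
on which the connection forms take the values `h`. -/
def liftField (A : Fin m → Base m → Base m →L[ℝ] ℝ) (M : Base m →L[ℝ] Base m)
    (h : Fin m → Base m → ℝ) (q : Tot m) : Tot m :=
  (M q.1, fun I => h I q.1 - A I q.1 (M q.1))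

variable {M N : Base m →L[ℝ] Base m} {h k : Fin m → Base m → ℝ}

lemma contDiffOn_liftField (hA : ∀ I, ContDiffOn ℝ ∞ (A I) S)
    (hh : ∀ I, ContDiffOn ℝ ∞ (h I) S) : ContDiffOn ℝ ∞ (liftField A M h) (totalSpace S) := by
  have hM : ContDiffOn ℝ ∞ M S := M.contDiff.contDiffOn
  have : ContDiffOn ℝ ∞ (fun p => (M p, fun I => h I p - A I p (M p))) S :=
    hM.prodMk (contDiffOn_pi.2 fun I => (hh I).sub ((hA I).clm_apply hM))
  exact this.comp contDiff_fst.contDiffOn fun q hq => mem_totalSpace.1 hq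

lemma fderiv_liftField (hS : IsOpen S) (hA : ∀ I, ContDiffOn ℝ ∞ (A I) S)
    (hh : ∀ I, ContDiffOn ℝ ∞ (h I) S) {q : Tot m} (hq : q.1 ∈ S) (y : Tot m) :
    fderiv ℝ (liftField A M h) q y = (M y.1, fun I =>
      fderiv ℝ (h I) q.1 y.1 - (fderiv ℝ (A I) q.1 y.1 (M q.1) + A I q.1 (M y.1))) := by
  have hd : HasFDerivAt (fun p => (M p, fun I => h I p - A I p (M p))) _ q.1 :=
    M.hasFDerivAt.prodMk (hasFDerivAt_pi.2 fun I =>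
      (differentiableAt_of_mem hS (hh I) hq).hasFDerivAt.fun_sub
        ((differentiableAt_of_mem hS (hA I) hq).hasFDerivAt.clm_apply M.hasFDerivAt))
  have := fderiv_comp_fst hd.differentiableAt y
  rw [hd.fderiv] at this
  refine this.trans ?_
  simp [add_comm]

/-- The fibre component is the usual formula for lifts: derivatives of the vertical values minus the
curvature on the two base fields, corrected by the connection on the base bracket. -/
lemma lieBracket_liftField (hS : IsOpen S) (hA : ∀ I, ContDiffOn ℝ ∞ (A I) S)
    (hh : ∀ I, ContDiffOn ℝ ∞ (h I) S) (hk : ∀ I, ContDiffOn ℝ ∞ (k I) S)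
    {q : Tot m} (hq : q.1 ∈ S) :
    VectorField.lieBracket ℝ (liftField A M h) (liftField A N k) q =
      (N (M q.1) - M (N q.1), fun I =>
        fderiv ℝ (k I) q.1 (M q.1) - fderiv ℝ (h I) q.1 (N q.1)
        - (fderiv ℝ (A I) q.1 (M q.1) (N q.1) - fderiv ℝ (A I) q.1 (N q.1) (M q.1))
        - A I q.1 (N (M q.1) - M (N q.1))) := by
  rw [VectorField.lieBracket, fderiv_liftField hS hA hk hq, fderiv_liftField hS hA hh hq]
  refine Prod.ext (by simp [liftField]) ?_
  funext I
  simp [liftField]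
  ring

/-- The values of the connection forms on the `i`-th rotational Killing field. -/
def momentValue (U : Base m → Matrix (Fin m) (Fin m) ℝ) (i : Fin 3) (I : Fin m) (p : Base m) : ℝ :=
  - 2 * ∑ J, U p I J * p J i

/-- The lift of the scaling generator. -/
def eulerLift (A : Fin m → Base m → Base m →L[ℝ] ℝ) : Tot m → Tot m :=
  liftField A ((2 : ℝ) • ContinuousLinearMap.id ℝ _) (fun _ _ => 0)

/-- The lifts of the rotation generators. -/
def rotLift (U : Base m → Matrix (Fin m) (Fin m) ℝ) (A : Fin m → Base m → Base m →L[ℝ] ℝ)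
    (i : Fin 3) : Tot m → Tot m :=
  liftField A ((2 : ℝ) • rotCLM i) (momentValue U i)

lemma contDiffOn_momentValue (hM : IsMonopole S U A) (i : Fin 3) (I : Fin m) :
    ContDiffOn ℝ ∞ (momentValue U i I) S := by
  refine contDiffOn_const.mul (ContDiffOn.sum fun J _ => (hM.smooth_higgs I J).mul ?_)
  exact (contDiff_apply_apply ℝ ℝ J i).contDiffOn

lemma fderiv_momentValue (hS : IsOpen S) (hM : IsMonopole S U A) {p : Base m} (hp : p ∈ S)
    (i : Fin 3) (I : Fin m) (v : Base m) : fderiv ℝ (momentValue U i I) p v =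
      - 2 * ∑ J, (U p I J * v J i + fderiv ℝ (fun p => U p I J) p v * p J i) := by
  have hc : ∀ J, HasFDerivAt (fun p : Base m => p J i)
      ((ContinuousLinearMap.proj (R := ℝ) (φ := fun _ : Fin 3 => ℝ) i).comp
        (ContinuousLinearMap.proj (R := ℝ) (φ := fun _ : Fin m => Fin 3 → ℝ) J)) p := fun J =>
    ((ContinuousLinearMap.proj (R := ℝ) (φ := fun _ : Fin 3 => ℝ) i).comp
        (ContinuousLinearMap.proj (R := ℝ) (φ := fun _ : Fin m => Fin 3 → ℝ) J)).hasFDerivAt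
  have := ((HasFDerivAt.fun_sum (u := Finset.univ) fun J _ => (differentiableAt_of_mem hS
    (hM.smooth_higgs I J) hp).hasFDerivAt.fun_mul (hc J)).const_mul (-2))
  have h2 : momentValue U i I = fun p => (-2) * ∑ J, U p I J * p J i := rfl
  rw [h2, this.fderiv]
  simp [mul_comm]

/-- The double cross product identity. -/
lemma rotField_rotField (c i : Fin 3) (p : Base m) (K : Fin m) (k : Fin 3) :
    rotField c (rotField i p) K k = (if k = i then p K c else 0) - (if c = i then p K k else 0) := by
  simp only [rotField, eps_eq]
  fin_cases c <;> fin_cases i <;> fin_cases k <;> simp [Fin.sum_univ_three] <;> ring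

/-- Rotation invariance in components: the three rotation derivatives are the antisymmetric parts in
a and b. -/
lemma fderiv_coordVec_comm (hC : IsConical S U) {p : Base m} (hp : p ∈ S) (I J : Fin m)
    (a b : Fin 3) : ∑ K, p K a * fderiv ℝ (fun p => U p I J) p (coordVec K b) =
      ∑ K, p K b * fderiv ℝ (fun p => U p I J) p (coordVec K a) := by
  have h := (hC p hp I J).2
  simp only [fun c => clm_apply_eq_sum (fderiv ℝ (fun p => U p I J) p) (rotField c p)] at h
  have h0 := h 0
  have h1 := h 1
  have h2 := h 2
  simp [rotField_zero, rotField_one, rotField_two, Fin.sum_univ_three, Finset.sum_add_distrib]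
    at h0 h1 h2
  fin_cases a <;> fin_cases b <;> simp <;> linarith

lemma fderiv_symm_apply (hS : IsOpen S) (hM : IsMonopole S U A) {p : Base m} (hp : p ∈ S)
    (I J : Fin m) (v : Base m) :
    fderiv ℝ (fun p => U p I J) p v = fderiv ℝ (fun p => U p J I) p v := by
  rw [fderiv_eq_of_eqOn hS (fun q hq => hM.symm q hq I J) hp]

/-- With the symmetry of `U`, the derivative of `U` is totally symmetric in its three labels. -/
lemma fderiv_exchange (hS : IsOpen S) (hM : IsMonopole S U A) {p : Base m} (hp : p ∈ S)
    (I J K : Fin m) (a : Fin 3) : fderiv ℝ (fun p => U p I J) p (coordVec K a) =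
      fderiv ℝ (fun p => U p I K) p (coordVec J a) := by
  rw [fderiv_symm_apply hS hM hp, hM.fderiv_symm p hp, fderiv_symm_apply hS hM hp]

lemma fderiv_rotField_rotField (hC : IsConical S U) {p : Base m} (hp : p ∈ S) (I J : Fin m)
    (c i : Fin 3) : fderiv ℝ (fun p => U p I J) p (rotField c (rotField i p)) =
      ∑ K, p K i * fderiv ℝ (fun p => U p I J) p (coordVec K c)
        + if c = i then U p I J else 0 := by
  have h : rotField c (rotField i p) = ∑ K, p K c • coordVec K i - if c = i then p else 0 := by
    funext K k
    rw [rotField_rotField]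
    by_cases hci : c = i
    · simp [hci, coordVec_apply, ite_and]
    · simp [hci, coordVec_apply, ite_and]
  rw [h, map_sub, map_sum, fderiv_coordVec_comm hC hp I J i c]
  simp only [map_smul, smul_eq_mul]
  split_ifs
  · rw [(hC p hp I J).1]; ring
  · simp

/-- The curvature on a pair of rotation generators. -/
lemma curvature_rotField (hS : IsOpen S) (hM : IsMonopole S U A) (hC : IsConical S U) {p : Base m} (hp : p ∈ S)
    (I : Fin m) (i j : Fin 3) :
    fderiv ℝ (A I) p (rotField i p) (rotField j p) - fderiv ℝ (A I) p (rotField j p) (rotField i p)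
      = ∑ K, U p I K * rotField j p K i := by
  rw [hM.curvature p hp]
  simp only [fderiv_rotField_rotField hC hp, mul_add, Finset.sum_add_distrib]
  -- Exchanging labels puts K on the derivative, so that the inner sum becomes the derivative of `U`
  -- along a rotation generator, which is zero.
  have h1 : ∑ K, ∑ c, rotField j p K c * ∑ J, p J i *
      fderiv ℝ (fun p => U p I K) p (coordVec J c) = 0 := by
    have : ∀ K, ∑ c, rotField j p K c * ∑ J, p J i *
        fderiv ℝ (fun p => U p I K) p (coordVec J c) = ∑ J, p J i * ∑ c, rotField j p K c *
          fderiv ℝ (fun p => U p I J) p (coordVec K c) := by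
      intro K
      simp only [Finset.mul_sum]
      rw [Finset.sum_comm]
      refine Finset.sum_congr rfl fun J _ => Finset.sum_congr rfl fun c _ => ?_
      rw [fderiv_exchange hS hM hp]; ring
    simp only [this]
    rw [Finset.sum_comm]
    refine Finset.sum_eq_zero fun J _ => ?_
    rw [← Finset.mul_sum, ← clm_apply_eq_sum, (hC p hp I J).2, mul_zero]
  rw [h1, zero_add]
  refine Finset.sum_congr rfl fun K _ => ?_
  simp [mul_comm]

/-- In the monopole equation the contraction with the position vector involves only rotation
derivatives of `U`. -/
lemma curvature_self (hM : IsMonopole S U A) (hC : IsConical S U) {p : Base m} (hp : p ∈ S)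
    (I : Fin m) (v : Base m) : fderiv ℝ (A I) p p v - fderiv ℝ (A I) p v p = 0 := by
  rw [hM.curvature p hp]
  simp [(hC p hp _ _).2]

/-- Invariance of `U` means that `momentValue` changes along a rotation only through its factor `p`.
The two such changes combine with the curvature from `curvature_rotField` to give the vertical
values required on the right. -/
theorem lieBracket_rotLift (hS : IsOpen S) (hM : IsMonopole S U A) (hC : IsConical S U)
    {q : Tot m} (hq : q.1 ∈ S) (i j : Fin 3) :
    VectorField.lieBracket ℝ (rotLift U A i) (rotLift U A j) q =
      ∑ k, (2 * eps i j k) • rotLift U A k q := by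
  have hr : rotField j (rotField i q.1) - rotField i (rotField j q.1)
      = ∑ k, eps i j k • rotField k q.1 := by
    funext K k
    simp only [Pi.sub_apply, rotField_rotField, Finset.sum_apply, Pi.smul_apply, smul_eq_mul,
      Fin.sum_univ_three, rotField_zero, rotField_one, rotField_two, eps_eq]
    fin_cases i <;> fin_cases j <;> fin_cases k <;> simp <;> ring
  rw [rotLift, rotLift, lieBracket_liftField hS hM.smooth_potential (contDiffOn_momentValue hM i)
    (contDiffOn_momentValue hM j) hq]
  have hr' : ((2 : ℝ) • rotCLM j) (((2 : ℝ) • rotCLM i) q.1)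
      - ((2 : ℝ) • rotCLM i) (((2 : ℝ) • rotCLM j) q.1) =
        ∑ k, (2 * eps i j k) • (2 : ℝ) • rotField k q.1 := by
    have : ∑ k, (2 * eps i j k) • (2 : ℝ) • rotField k q.1 =
      (4 : ℝ) • ∑ k, eps i j k • rotField k q.1 := by
      rw [Finset.smul_sum]
      refine Finset.sum_congr rfl fun k _ => ?_
      rw [smul_smul, smul_smul]; congr 1; ring
    rw [this, ← hr]
    simp only [smul_apply, rotCLM_apply, map_smul, smul_sub, smul_smul]
    simp only [← rotCLM_apply]
    norm_num
  rw [hr']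
  refine Prod.ext ?_ ?_
  · simp [rotLift, liftField, Prod.fst_sum]
  funext I
  have hc := curvature_rotField hS hM hC hq I i j
  simp only [rotLift, liftField, Prod.snd_sum, Finset.sum_apply, Prod.smul_snd, Pi.smul_apply,
    smul_eq_mul, mul_sub, Finset.sum_sub_distrib, map_sum, map_smul, smul_apply, rotCLM_apply]
  congr 1
  simp only [fderiv_momentValue hS hM hq, (hC q.1 hq _ _).2, momentValue]
  -- The factor 4 arises because both base fields are twice the generators.
  have h4 : 2 * (2 * fderiv ℝ (A I) q.1 (rotField i q.1) (rotField j q.1))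
    - 2 * (2 * fderiv ℝ (A I) q.1 (rotField j q.1) (rotField i q.1)) =
      4 * ∑ K, U q.1 I K * rotField j q.1 K i := by linarith
  rw [h4]
  simp only [Finset.mul_sum, ← Finset.sum_sub_distrib]
  rw [Finset.sum_comm]
  refine Finset.sum_congr rfl fun K _ => ?_
  simp only [Fin.sum_univ_three, rotField, eps_eq]
  fin_cases i <;> fin_cases j <;> simp <;> ring

theorem lieBracket_rotLift_eulerLift (hS : IsOpen S) (hM : IsMonopole S U A) (hC : IsConical S U)
    {q : Tot m} (hq : q.1 ∈ S) (i : Fin 3) :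
    VectorField.lieBracket ℝ (rotLift U A i) (eulerLift A) q = 0 := by
  rw [rotLift, eulerLift, lieBracket_liftField hS hM.smooth_potential (contDiffOn_momentValue hM i)
    (fun _ => contDiffOn_const) hq]
  refine Prod.ext ?_ ?_
  · simp
  funext I
  have hc := curvature_self hM hC hq I (rotField i q.1)
  simp [fderiv_momentValue hS hM hq, (hC q.1 hq _ _).1]
  have h0 : ∑ x, (U q.1 I x * (2 * q.1 x i) + -(2 * U q.1 I x * q.1 x i)) = 0 :=
    Finset.sum_eq_zero fun x _ => by ring
  rw [h0]
  linarith

end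

section

variable {S : Set (Base m)} {U : Base m → Matrix (Fin m) (Fin m) ℝ}
  {A : Fin m → Base m → Base m →L[ℝ] ℝ}

/-! ### The canonical vector fields -/

/-- The vertical 1-forms for the connection `A`. -/
def vert (A : Fin m → Base m → Base m →L[ℝ] ℝ) (I : Fin m) (p : Base m) (v : Tot m) : ℝ :=
  v.2 I + A I p v.1

/-- The Gibbons-Hawking metric with Higgs field `U` and connection `A`. -/
def monopoleMetric (U : Base m → Matrix (Fin m) (Fin m) ℝ) (A : Fin m → Base m → Base m →L[ℝ] ℝ)
    (q v w : Tot m) : ℝ :=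
  (∑ I, ∑ J, U q.1 I J * ∑ i, v.1 I i * w.1 J i)
  + ∑ I, ∑ J, (U q.1)⁻¹ I J * (vert A I q.1 v * vert A J q.1 w)

lemma eq_liftField {M : Base m →L[ℝ] Base m} {h : Fin m → Base m → ℝ} {q v : Tot m}
    (h1 : v.1 = M q.1) (h2 : ∀ I, vert A I q.1 v = h I q.1) : v = liftField A M h q := by
  refine Prod.ext h1 ?_
  funext I
  simp [liftField, ← h2 I, vert, h1]

@[simp] lemma vert_liftField {M : Base m →L[ℝ] Base m} {h : Fin m → Base m → ℝ} {q : Tot m}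
    (I : Fin m) : vert A I q.1 (liftField A M h q) = h I q.1 := by
  simp [vert, liftField]

lemma rotField_self (i : Fin 3) (p : Base m) (K : Fin m) : rotField i p K i = 0 := by
  fin_cases i <;> simp [rotField_zero, rotField_one, rotField_two]

lemma monopoleMetric_eulerLift (q w : Tot m) : monopoleMetric U A q (eulerLift A q) w =
    2 * ∑ I, ∑ J, U q.1 I J * ∑ i, q.1 I i * w.1 J i := by
  simp only [monopoleMetric, eulerLift, vert_liftField]
  simp [liftField, Finset.mul_sum]
  refine Finset.sum_congr rfl fun I _ => Finset.sum_congr rfl fun J _ =>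
    Finset.sum_congr rfl fun i _ => by ring

variable {L : Base m → ℝ} {α : Fin m → Base m → (Base m →L[ℝ] ℝ)}

lemma metricG_eq (hA : ∀ p ∈ S, ∀ I v, connForm L α I p v = A I p v) {q : Tot m} (hq : q.1 ∈ S)
    (v w : Tot m) : metricG L α q v w = monopoleMetric (higgs L) A q v w := by
  simp only [metricG, monopoleMetric, theta, vert, hA q.1 hq]

/-- Contraction of `Ω_i` with a field over a rotation generator. -/
lemma Omega_rotField (hA : ∀ p ∈ S, ∀ I v, connForm L α I p v = A I p v)
    (hsymm : ∀ p ∈ S, ∀ I J, higgs L p I J = higgs L p J I) {q : Tot m} (hq : q.1 ∈ S)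
    (i : Fin 3) {v : Tot m} (hv : v.1 = (2 : ℝ) • rotField i q.1) (w : Tot m) :
    Omega L α i q v w =
      - 2 * (∑ I, ∑ J, higgs L q.1 I J * ((∑ j, q.1 I j * w.1 J j) - q.1 I i * w.1 J i))
        + ∑ K, w.1 K i * vert A K q.1 v := by
  have h1 : ∑ K, (v.1 K i * theta L α K q w - w.1 K i * theta L α K q v) =
      - ∑ K, w.1 K i * vert A K q.1 v := by
    rw [← Finset.sum_neg_distrib]
    refine Finset.sum_congr rfl fun K _ => ?_
    simp [hv, rotField_self, theta, vert, hA q.1 hq]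
  have h2 : ∑ I, ∑ J, higgs L q.1 I J *
      ∑ j, ∑ k, eps i j k * (v.1 I j * w.1 J k - w.1 I j * v.1 J k) =
      ∑ I, ∑ J, higgs L q.1 I J * (2 * ∑ j, ∑ k, eps i j k * (v.1 I j * w.1 J k)) := by
    -- The antisymmetry of ε makes the second half of the wedge equal to the first with I and J
    -- interchanged, so symmetry of `U` doubles the sum.
    have e : ∀ I J, ∑ j, ∑ k, eps i j k * (v.1 I j * w.1 J k - w.1 I j * v.1 J k) =
        (∑ j, ∑ k, eps i j k * (v.1 I j * w.1 J k)) +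
          ∑ j, ∑ k, eps i j k * (v.1 J j * w.1 I k) := by
      intro I J
      simp only [Fin.sum_univ_three, eps_eq]
      fin_cases i <;> simp <;> ring
    simp only [e, mul_add, two_mul, Finset.sum_add_distrib]
    congr 1
    rw [Finset.sum_comm]
    refine Finset.sum_congr rfl fun I _ => Finset.sum_congr rfl fun J _ => ?_
    rw [hsymm q.1 hq]
  rw [Omega, h1, h2, sub_neg_eq_add]
  congr 1
  rw [Finset.mul_sum, Finset.mul_sum]
  refine Finset.sum_congr rfl fun I _ => ?_
  rw [Finset.mul_sum, Finset.mul_sum]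
  refine Finset.sum_congr rfl fun J _ => ?_
  simp only [hv, Pi.smul_apply, smul_eq_mul, Fin.sum_univ_three, eps_eq]
  fin_cases i <;> simp [rotField_zero, rotField_one, rotField_two] <;> ring

/-- The double cross product omits the i-th summand of the inner product; the vertical values
`momentValue`, with their factor -2, are chosen to restore it. -/
lemma Omega_rotLift (hA : ∀ p ∈ S, ∀ I v, connForm L α I p v = A I p v)
    (hsymm : ∀ p ∈ S, ∀ I J, higgs L p I J = higgs L p J I) {q : Tot m} (hq : q.1 ∈ S)
    (i : Fin 3) (w : Tot m) :
    Omega L α i q (rotLift (higgs L) A i q) w = - metricG L α q (eulerLift A q) w := by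
  rw [metricG_eq hA hq, monopoleMetric_eulerLift, Omega_rotField hA hsymm hq i rfl]
  simp only [rotLift, vert_liftField, momentValue, mul_sub, Finset.sum_sub_distrib]
  have : ∑ K, w.1 K i * (-2 * ∑ J, higgs L q.1 K J * q.1 J i) =
      - 2 * ∑ I, ∑ J, higgs L q.1 I J * (q.1 I i * w.1 J i) := by
    simp only [Finset.mul_sum]
    rw [Finset.sum_comm]
    refine Finset.sum_congr rfl fun I _ => Finset.sum_congr rfl fun J _ => ?_
    rw [hsymm q.1 hq]; ring
  rw [this]
  ring

/-- The canonical vector fields which cover the collective action are unique. -/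
lemma eq_lift_of_canonical (hA : ∀ p ∈ S, ∀ I v, connForm L α I p v = A I p v)
    (hsymm : ∀ p ∈ S, ∀ I J, higgs L p I J = higgs L p J I)
    (hdet : ∀ p ∈ S, (higgs L p).det ≠ 0) {q : Tot m} (hq : q.1 ∈ S) {x : Tot m}
    {i : Fin 3} {y : Tot m} (hx : x.1 = (2 : ℝ) • q.1) (hy : y.1 = (2 : ℝ) • rotField i q.1)
    (h : ∀ v, Omega L α i q y v = - metricG L α q x v) :
    x = eulerLift A q := by
  refine eq_liftField (by simpa using hx) ?_
  -- On vertical vectors the left side of `h` vanishes, since the i-th rotation generator has no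
  -- component along direction i. Invertibility of `U` then makes `x` horizontal.
  have h1 : Matrix.vecMul (fun I => vert A I q.1 x) (higgs L q.1)⁻¹ = 0 := by
    funext K
    have := h (0, Pi.single K 1)
    rw [metricG_eq hA hq, Omega_rotField hA hsymm hq i hy] at this
    simp [monopoleMetric, vert, Pi.single_apply] at this
    simp only [Matrix.vecMul, dotProduct, vert, Pi.zero_apply]
    rw [← this]
    exact Finset.sum_congr rfl fun I _ => mul_comm _ _
  have hu : IsUnit (higgs L q.1).det := isUnit_iff_ne_zero.2 (hdet q.1 hq)
  have h2 : Matrix.vecMul (Matrix.vecMul (fun I => vert A I q.1 x) (higgs L q.1)⁻¹) (higgs L q.1)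
      = 0 := by rw [h1, Matrix.zero_vecMul]
  rw [Matrix.vecMul_vecMul, Matrix.nonsing_inv_mul _ hu, Matrix.vecMul_one] at h2
  exact fun I => congrFun h2 I

/-! ### The Levi-Civita connection -/

/-- Cramer's rule: each entry of the inverse is a quotient of determinants in the entries of `U`. -/
lemma differentiableAt_inv_apply (hS : IsOpen S) (hU : ∀ I J, ContDiffOn ℝ ∞ (fun p => U p I J) S)
    {p : Base m} (hp : p ∈ S) (hdet : (U p).det ≠ 0) (I J : Fin m) :
    DifferentiableAt ℝ (fun p => (U p)⁻¹ I J) p := by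
  have h : ∀ V : Base m → Matrix (Fin m) (Fin m) ℝ,
      (∀ I J, DifferentiableAt ℝ (fun p => V p I J) p) →
      DifferentiableAt ℝ (fun p => (V p).det) p := by
    intro V hV
    simp only [Matrix.det_apply]
    refine DifferentiableAt.fun_sum fun σ _ => DifferentiableAt.const_smul ?_ _
    exact (HasFDerivAt.finsetProd fun K _ => (hV (σ K) K).hasFDerivAt).differentiableAt
  have hd := fun I J => differentiableAt_of_mem hS (hU I J) hp
  simp only [Matrix.inv_def, Matrix.smul_apply, smul_eq_mul, Ring.inverse_eq_inv',
    Matrix.adjugate_apply]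
  refine ((h U hd).fun_inv hdet).fun_mul (h _ fun K K' => ?_)
  by_cases hK : K = J
  · subst hK; simp
  · simpa [Matrix.updateRow_ne hK] using hd K K'

lemma fderiv_inv_self (hS : IsOpen S) (hM : IsMonopole S U A) (hdet : ∀ p ∈ S, (U p).det ≠ 0)
    (hC : IsConical S U) {p : Base m} (hp : p ∈ S) (I J : Fin m) :
    fderiv ℝ (fun p => (U p)⁻¹ I J) p p = (U p)⁻¹ I J := by
  have hu : IsUnit (U p).det := isUnit_iff_ne_zero.2 (hdet p hp)
  set W : Matrix (Fin m) (Fin m) ℝ :=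
    Matrix.of fun I J => fderiv ℝ (fun p => (U p)⁻¹ I J) p p with hW
  -- Differentiate `U⁻¹ U = 1` along the scaling field and insert degree -1 for `U`.
  have key : W * U p = 1 := by
    ext I K
    have h0 : ∀ q ∈ S, ∑ J, (U q)⁻¹ I J * U q J K = (1 : Matrix (Fin m) (Fin m) ℝ) I K :=
      fun q hq => by
        rw [← Matrix.mul_apply, Matrix.nonsing_inv_mul _ (isUnit_iff_ne_zero.2 (hdet q hq))]
    have h1 := fderiv_eq_of_eqOn hS h0 hp
    rw [(HasFDerivAt.fun_sum fun J _ => (differentiableAt_inv_apply hS hM.smooth_higgs hp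
      (hdet p hp) I J).hasFDerivAt.fun_mul
        (differentiableAt_of_mem hS (hM.smooth_higgs J K) hp).hasFDerivAt).fderiv] at h1
    have h2 := congrArg (fun f => f p) h1
    simp [(hC p hp _ _).1, Finset.sum_add_distrib] at h2
    rw [Matrix.mul_apply, ← h0 p hp]
    simp only [hW, Matrix.of_apply]
    rw [neg_add_eq_zero] at h2
    rw [h2]
    exact Finset.sum_congr rfl fun J _ => mul_comm _ _
  have : W = (U p)⁻¹ := by
    rw [← Matrix.mul_nonsing_inv_cancel_right _ W hu, key, one_mul]
  exact congrFun (congrFun this I) J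

lemma fderiv_monopoleMetric (hS : IsOpen S) (hM : IsMonopole S U A)
    (hdet : ∀ p ∈ S, (U p).det ≠ 0) {q : Tot m} (hq : q.1 ∈ S) (x y z : Tot m) :
    fderiv ℝ (fun q => monopoleMetric U A q y z) q x =
      (∑ I, ∑ J, fderiv ℝ (fun p => U p I J) q.1 x.1 * ∑ i, y.1 I i * z.1 J i)
      + ∑ I, ∑ J, (fderiv ℝ (fun p => (U p)⁻¹ I J) q.1 x.1 * (vert A I q.1 y * vert A J q.1 z)
        + (U q.1)⁻¹ I J * (fderiv ℝ (A I) q.1 x.1 y.1 * vert A J q.1 z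
          + vert A I q.1 y * fderiv ℝ (A J) q.1 x.1 z.1)) := by
  have hv : ∀ I (y : Tot m), HasFDerivAt (fun p => vert A I p y) _ q.1 := fun I y =>
    ((differentiableAt_of_mem hS (hM.smooth_potential I) hq).hasFDerivAt.clm_apply
      (hasFDerivAt_const y.1 _)).const_add (y.2 I)
  have hU := fun I J => (differentiableAt_of_mem hS (hM.smooth_higgs I J) hq).hasFDerivAt
  have hV := fun I J =>
    (differentiableAt_inv_apply hS hM.smooth_higgs hq (hdet q.1 hq) I J).hasFDerivAt
  have hd := (HasFDerivAt.fun_sum (u := Finset.univ) fun I _ =>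
      HasFDerivAt.fun_sum (u := Finset.univ) fun J _ =>
        (hU I J).mul_const (∑ i, y.1 I i * z.1 J i)).fun_add
    (HasFDerivAt.fun_sum (u := Finset.univ) fun I _ =>
      HasFDerivAt.fun_sum (u := Finset.univ) fun J _ =>
        (hV I J).fun_mul ((hv I y).fun_mul (hv J z)))
  have := fderiv_comp_fst hd.differentiableAt x
  rw [hd.fderiv] at this
  refine this.trans ?_
  simp only [add_apply, sum_apply, smul_apply, smul_eq_mul]
  congr 1
  · exact Finset.sum_congr rfl fun I _ => Finset.sum_congr rfl fun J _ => mul_comm _ _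
  · refine Finset.sum_congr rfl fun I _ => Finset.sum_congr rfl fun J _ => ?_
    simp
    ring

lemma fderiv_metric_eulerLift (hS : IsOpen S) (hM : IsMonopole S U A) {q : Tot m} (hq : q.1 ∈ S)
    (y z : Tot m) :
    fderiv ℝ (fun q => monopoleMetric U A q (eulerLift A q) z) q y =
      2 * ∑ I, ∑ J, (fderiv ℝ (fun p => U p I J) q.1 y.1 * (∑ i, q.1 I i * z.1 J i)
        + U q.1 I J * ∑ i, y.1 I i * z.1 J i) := by
  simp only [monopoleMetric_eulerLift]
  have hU := fun I J => (differentiableAt_of_mem hS (hM.smooth_higgs I J) hq).hasFDerivAt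
  have hc : ∀ I i, HasFDerivAt (fun p : Base m => p I i)
      ((ContinuousLinearMap.proj (R := ℝ) (φ := fun _ : Fin 3 => ℝ) i).comp
        (ContinuousLinearMap.proj (R := ℝ) (φ := fun _ : Fin m => Fin 3 → ℝ) I)) q.1 := fun I i =>
    ((ContinuousLinearMap.proj (R := ℝ) (φ := fun _ : Fin 3 => ℝ) i).comp
        (ContinuousLinearMap.proj (R := ℝ) (φ := fun _ : Fin m => Fin 3 → ℝ) I)).hasFDerivAt
  have hd := (HasFDerivAt.fun_sum (u := Finset.univ) fun I _ =>
      HasFDerivAt.fun_sum (u := Finset.univ) fun J _ => (hU I J).fun_mul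
        (HasFDerivAt.fun_sum (u := Finset.univ) fun i _ =>
          (hc I i).mul_const (z.1 J i))).const_mul 2
  have := fderiv_comp_fst hd.differentiableAt y
  rw [hd.fderiv] at this
  refine this.trans ?_
  simp only [add_apply, sum_apply, smul_apply, smul_eq_mul]
  congr 1
  refine Finset.sum_congr rfl fun I _ => Finset.sum_congr rfl fun J _ => ?_
  simp [mul_comm, add_comm]

lemma monopoleMetric_comm (hM : IsMonopole S U A) {q : Tot m} (hq : q.1 ∈ S) (y z : Tot m) :
    monopoleMetric U A q y z = monopoleMetric U A q z y := by
  have hU : (U q.1).transpose = U q.1 := by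
    ext I J
    exact hM.symm q.1 hq J I
  have hV : ∀ I J, (U q.1)⁻¹ I J = (U q.1)⁻¹ J I := fun I J => by
    conv_rhs => rw [← hU, ← Matrix.transpose_nonsing_inv, Matrix.transpose_apply]
  unfold monopoleMetric
  congr 1
  · rw [Finset.sum_comm]
    refine Finset.sum_congr rfl fun I _ => Finset.sum_congr rfl fun J _ => ?_
    rw [hM.symm q.1 hq]
    exact congrArg _ (Finset.sum_congr rfl fun i _ => mul_comm _ _)
  · rw [Finset.sum_comm]
    refine Finset.sum_congr rfl fun I _ => Finset.sum_congr rfl fun J _ => ?_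
    rw [hV, mul_comm (vert A J q.1 y)]

/-- The covariant derivative of the lifted scaling field. -/
lemma leviCivita_eulerLift (hS : IsOpen S) (hM : IsMonopole S U A)
    (hdet : ∀ p ∈ S, (U p).det ≠ 0) {q : Tot m} (hq : q.1 ∈ S) (y z : Tot m) :
    leviCivita (monopoleMetric U A) (fun _ => y) (eulerLift A) (fun _ => z) q =
      (∑ I, ∑ J, fderiv ℝ (fun p => U p I J) q.1 y.1 * ∑ i, q.1 I i * z.1 J i)
      - (∑ I, ∑ J, fderiv ℝ (fun p => U p I J) q.1 z.1 * ∑ i, q.1 I i * y.1 J i)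
      + (∑ I, ∑ J, (fderiv ℝ (fun p => U p I J) q.1 q.1 + 2 * U q.1 I J) * ∑ i, y.1 I i * z.1 J i)
      + ∑ I, ∑ J, (fderiv ℝ (fun p => (U p)⁻¹ I J) q.1 q.1 * (vert A I q.1 y * vert A J q.1 z)
        + (U q.1)⁻¹ I J *
          ((fderiv ℝ (A I) q.1 q.1 y.1 - fderiv ℝ (A I) q.1 y.1 q.1) * vert A J q.1 z
          + vert A I q.1 y * (fderiv ℝ (A J) q.1 q.1 z.1 - fderiv ℝ (A J) q.1 z.1 q.1))) := by
  have hX : ∀ y, fderiv ℝ (eulerLift A) q y = ((2 : ℝ) • y.1, fun I =>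
      - (fderiv ℝ (A I) q.1 y.1 ((2 : ℝ) • q.1) + A I q.1 ((2 : ℝ) • y.1))) := fun y => by
    rw [eulerLift, fderiv_liftField hS hM.smooth_potential (fun _ => contDiffOn_const) hq]
    simp
  have b1 : VectorField.lieBracket ℝ (fun _ => y) (eulerLift A) q = fderiv ℝ (eulerLift A) q y := by
    simp [VectorField.lieBracket]
  have b2 : VectorField.lieBracket ℝ (eulerLift A) (fun _ => z) q =
      - fderiv ℝ (eulerLift A) q z := by
    simp [VectorField.lieBracket]
  have b3 : VectorField.lieBracket ℝ (fun _ => y) (fun _ => z) q = 0 := by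
    simp [VectorField.lieBracket]
  have hv : ∀ I y, vert A I q.1 (fderiv ℝ (eulerLift A) q y) =
      - (2 * fderiv ℝ (A I) q.1 y.1 q.1) := fun I y => by
    rw [hX]; simp [vert]
  have hX1 : (eulerLift A q).1 = (2 : ℝ) • q.1 := rfl
  have c : monopoleMetric U A q (- fderiv ℝ (eulerLift A) q z) y =
      - monopoleMetric U A q y (fderiv ℝ (eulerLift A) q z) := by
    rw [monopoleMetric_comm hM hq y]
    simp only [monopoleMetric, vert, Prod.fst_neg, Prod.snd_neg, Pi.neg_apply, map_neg,
      ← neg_add, neg_mul, mul_neg, Finset.sum_neg_distrib]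
  have z0 : monopoleMetric U A q 0 (eulerLift A q) = 0 := by
    simp [monopoleMetric, vert]
  have hs : ∑ I, ∑ J, U q.1 I J * ∑ i, y.1 I i * z.1 J i =
      ∑ I, ∑ J, U q.1 I J * ∑ i, z.1 I i * y.1 J i := by
    rw [Finset.sum_comm]
    refine Finset.sum_congr rfl fun I _ => Finset.sum_congr rfl fun J _ => ?_
    rw [hM.symm q.1 hq]
    exact congrArg _ (Finset.sum_congr rfl fun i _ => mul_comm _ _)
  have hs' : ∀ y z : Tot m, ∑ I, ∑ J, (fderiv ℝ (fun p => U p I J) q.1 y.1 *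
        (∑ i, q.1 I i * z.1 J i) + U q.1 I J * ∑ i, y.1 I i * z.1 J i) =
      ∑ I, ∑ J, fderiv ℝ (fun p => U p I J) q.1 y.1 * (∑ i, q.1 I i * z.1 J i)
        + ∑ I, ∑ J, U q.1 I J * ∑ i, y.1 I i * z.1 J i := fun y z => by
    simp only [Finset.sum_add_distrib]
  have t2 : fderiv ℝ (fun q => monopoleMetric U A q y z) q (eulerLift A q) =
      2 * (∑ I, ∑ J, fderiv ℝ (fun p => U p I J) q.1 q.1 * ∑ i, y.1 I i * z.1 J i)
      + 2 * ∑ I, ∑ J, (fderiv ℝ (fun p => (U p)⁻¹ I J) q.1 q.1 * (vert A I q.1 y * vert A J q.1 z)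
        + (U q.1)⁻¹ I J * (fderiv ℝ (A I) q.1 q.1 y.1 * vert A J q.1 z
          + vert A I q.1 y * fderiv ℝ (A J) q.1 q.1 z.1)) := by
    rw [fderiv_monopoleMetric hS hM hdet hq, hX1]
    simp only [map_smul, smul_apply, smul_eq_mul, Finset.mul_sum]
    congr 1 <;> refine Finset.sum_congr rfl fun I _ => Finset.sum_congr rfl fun J _ => ?_
    · exact Finset.sum_congr rfl fun _ _ => by ring
    · ring
  have t3 : monopoleMetric U A q (fderiv ℝ (eulerLift A) q y) z =
      2 * (∑ I, ∑ J, U q.1 I J * ∑ i, y.1 I i * z.1 J i)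
      - 2 * ∑ I, ∑ J, (U q.1)⁻¹ I J * (fderiv ℝ (A I) q.1 y.1 q.1 * vert A J q.1 z) := by
    simp only [monopoleMetric, hv]
    rw [hX, sub_eq_add_neg, ← neg_mul]
    simp only [Finset.mul_sum, Pi.smul_apply, smul_eq_mul]
    congr 1 <;> refine Finset.sum_congr rfl fun I _ => Finset.sum_congr rfl fun J _ => ?_
    · exact Finset.sum_congr rfl fun _ _ => by ring
    · ring
  have t4 : monopoleMetric U A q y (fderiv ℝ (eulerLift A) q z) =
      2 * (∑ I, ∑ J, U q.1 I J * ∑ i, y.1 I i * z.1 J i)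
      - 2 * ∑ I, ∑ J, (U q.1)⁻¹ I J * (vert A I q.1 y * fderiv ℝ (A J) q.1 z.1 q.1) := by
    simp only [monopoleMetric, hv]
    rw [hX, sub_eq_add_neg, ← neg_mul]
    simp only [Finset.mul_sum, Pi.smul_apply, smul_eq_mul]
    congr 1 <;> refine Finset.sum_congr rfl fun I _ => Finset.sum_congr rfl fun J _ => ?_
    · exact Finset.sum_congr rfl fun _ _ => by ring
    · ring
  -- In the result, the first two sums are half the exterior derivative of the 1-form dual to the
  -- lifted field; the others are half the Lie derivative of the metric.
  simp only [leviCivita]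
  rw [b1, b2, b3, c, z0, fderiv_metric_eulerLift hS hM hq, fderiv_metric_eulerLift hS hM hq,
    t2, t3, t4, hs', hs', ← hs]
  simp only [add_mul, mul_add, sub_mul, mul_sub, Finset.sum_add_distrib, Finset.sum_sub_distrib,
    mul_assoc, ← Finset.mul_sum]
  ring

end

/-! ### The Euler condition is equivalent to conicality. -/

section

variable {S : Set (Base m)} {U : Base m → Matrix (Fin m) (Fin m) ℝ}
  {A : Fin m → Base m → Base m →L[ℝ] ℝ}

/-- Rotational invariance makes the 1-form dual to the lifted scaling field closed. -/
lemma sum_fderiv_inner_comm (hS : IsOpen S) (hM : IsMonopole S U A) (hC : IsConical S U)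
    {p : Base m} (hp : p ∈ S) (y z : Base m) :
    ∑ I, ∑ J, fderiv ℝ (fun p => U p I J) p y * ∑ i, p I i * z J i =
      ∑ I, ∑ J, fderiv ℝ (fun p => U p I J) p z * ∑ i, p I i * y J i := by
  -- The symmetry of the derivative of `U` moves the label contracted with `p` onto the derivative,
  -- where rotation invariance can interchange a and i.
  have e : ∀ y z : Base m, ∑ I, ∑ J, fderiv ℝ (fun p => U p I J) p y * ∑ i, p I i * z J i =
      ∑ J, ∑ K, ∑ i, ∑ a, y K a * z J i *
        ∑ I, p I i * fderiv ℝ (fun p => U p K J) p (coordVec I a) := by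
    intro y z
    rw [Finset.sum_comm]
    refine Finset.sum_congr rfl fun J _ => ?_
    have e1 : ∀ I, fderiv ℝ (fun p => U p I J) p y * ∑ i, p I i * z J i = ∑ K, ∑ i, ∑ a,
        y K a * z J i * (p I i * fderiv ℝ (fun p => U p K J) p (coordVec I a)) := by
      intro I
      rw [clm_apply_eq_sum, Finset.sum_mul]
      refine Finset.sum_congr rfl fun K _ => ?_
      rw [Finset.mul_sum]
      refine Finset.sum_congr rfl fun i _ => ?_
      rw [Finset.sum_mul]
      refine Finset.sum_congr rfl fun a _ => ?_
      rw [hM.fderiv_symm p hp]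
      ring
    simp only [e1, Finset.mul_sum]
    rw [Finset.sum_comm]
    refine Finset.sum_congr rfl fun K _ => ?_
    rw [Finset.sum_comm]
    refine Finset.sum_congr rfl fun i _ => ?_
    rw [Finset.sum_comm]
  rw [e, e, Finset.sum_comm]
  refine Finset.sum_congr rfl fun J _ => Finset.sum_congr rfl fun K _ => ?_
  rw [Finset.sum_comm]
  refine Finset.sum_congr rfl fun a _ => Finset.sum_congr rfl fun i _ => ?_
  rw [fderiv_coordVec_comm hC hp]
  simp only [fderiv_symm_apply hS hM hp J K]
  ring

/-- The closedness terms cancel, the curvature terms vanish, and the weights add up: `U` has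
coefficient -1 + 2 = 1, while `U⁻¹` has degree 1. -/
theorem isHomotheticEuler_eulerLift (hS : IsOpen S) (hM : IsMonopole S U A)
    (hdet : ∀ p ∈ S, (U p).det ≠ 0) (hC : IsConical S U) :
    IsHomotheticEuler (totalSpace S) (monopoleMetric U A) (eulerLift A) := by
  intro q hq y z
  rw [mem_totalSpace] at hq
  rw [leviCivita_eulerLift hS hM hdet hq, sum_fderiv_inner_comm hS hM hC hq, sub_self, zero_add]
  simp only [fderiv_inv_self hS hM hdet hC hq, (hC q.1 hq _ _).1, curvature_self hM hC hq,
    zero_mul, mul_zero, add_zero, monopoleMetric]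
  congr 1
  exact Finset.sum_congr rfl fun I _ => Finset.sum_congr rfl fun J _ => by ring

theorem isConical_of_isHomotheticEuler (hS : IsOpen S) (hM : IsMonopole S U A)
    (hdet : ∀ p ∈ S, (U p).det ≠ 0)
    (hE : IsHomotheticEuler (totalSpace S) (monopoleMetric U A) (eulerLift A)) :
    IsConical S U := by
  intro p hp
  set q : Tot m := (p, 0) with hqdef
  have hq : q.1 ∈ S := hp
  have hu : IsUnit (U p).det := isUnit_iff_ne_zero.2 (hdet p hp)
  have hl := fun y z => (leviCivita_eulerLift hS hM hdet hq y z).symm.trans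
    (hE q (mem_totalSpace.2 hq) y z)
  let hor : Base m → Tot m := fun v => (v, fun I => - A I p v)
  have hh : ∀ v I, vert A I q.1 (hor v) = 0 := fun v I => by simp [vert, hor, hqdef]
  -- Pairing a horizontal with a vertical vector isolates the curvature contraction, multiplied by
  -- the invertible matrix `U⁻¹`.
  have hcurv : ∀ I v, fderiv ℝ (A I) p p v - fderiv ℝ (A I) p v p = 0 := by
    intro I v
    have h1 : Matrix.vecMul (fun I => fderiv ℝ (A I) p p v - fderiv ℝ (A I) p v p) (U p)⁻¹ = 0 := by
      funext K
      have h := hl (hor v) (0, Pi.single K 1)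
      simp only [hh, monopoleMetric] at h
      simp [vert, Pi.single_apply] at h
      simp only [Matrix.vecMul, dotProduct, Pi.zero_apply]
      rw [← h]
      exact Finset.sum_congr rfl fun I _ => mul_comm _ _
    have h2 : Matrix.vecMul (Matrix.vecMul
        (fun I => fderiv ℝ (A I) p p v - fderiv ℝ (A I) p v p) (U p)⁻¹) (U p) = 0 := by
      rw [h1, Matrix.zero_vecMul]
    rw [Matrix.vecMul_vecMul, Matrix.nonsing_inv_mul _ hu, Matrix.vecMul_one] at h2
    exact congrFun h2 I
  intro I J
  refine ⟨?_, fun c => ?_⟩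
  -- Adding the formula for the two orders of a horizontal pair cancels the antisymmetric part and
  -- leaves homogeneity.
  · have h1 := hl (hor (coordVec I 0)) (hor (coordVec J 0))
    have h2 := hl (hor (coordVec J 0)) (hor (coordVec I 0))
    simp only [hh, monopoleMetric, zero_mul, mul_zero, add_zero, Finset.sum_const_zero] at h1 h2
    have e : ∀ I J K M, ∑ i, (hor (coordVec I 0)).1 K i * (hor (coordVec J 0)).1 M i =
        if K = I then (if M = J then 1 else 0) else 0 := by
      intro I J K M
      simp only [hor, coordVec_apply, Fin.sum_univ_three]
      by_cases hK : K = I <;> by_cases hM : M = J <;> simp [hK, hM]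
    simp only [e] at h1 h2
    simp [hor, hqdef] at h1 h2
    have s1 := fderiv_symm_apply hS hM hp I J p
    have s2 := hM.symm p hp I J
    linarith
  -- With a coordinate vector in the second slot, the monopole equation reduces to a single rotation
  -- derivative of `U`.
  · have h := hM.curvature p hp I p (coordVec J c)
    rw [hcurv] at h
    simpa [coordVec_apply, ite_and] using h.symm

variable {L : Base m → ℝ} {α : Fin m → Base m → (Base m →L[ℝ] ℝ)}

/-- The homothetic Euler condition is local in the metric and the vector field. -/
lemma isHomotheticEuler_congr {E : Type*} [NormedAddCommGroup E] [NormedSpace ℝ E] {N : Set E}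
    (hN : IsOpen N) {g g' : E → E → E → ℝ} {X X' : E → E}
    (hg : ∀ q ∈ N, ∀ v w, g q v w = g' q v w) (hX : ∀ q ∈ N, X q = X' q) :
    IsHomotheticEuler N g X ↔ IsHomotheticEuler N g' X' := by
  refine forall₂_congr fun q hq => forall₂_congr fun y z => ?_
  have hn := hN.mem_nhds hq
  have e1 : ∀ z, fderiv ℝ (fun q => g q (X q) z) q = fderiv ℝ (fun q => g' q (X' q) z) q := fun z =>
    Filter.EventuallyEq.fderiv_eq (Filter.eventually_of_mem hn fun r hr => by
      simp only [hg r hr, hX r hr])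
  have e2 : fderiv ℝ (fun q => g q y z) q = fderiv ℝ (fun q => g' q y z) q :=
    Filter.EventuallyEq.fderiv_eq (Filter.eventually_of_mem hn fun r hr => hg r hr y z)
  have e3 : fderiv ℝ X q = fderiv ℝ X' q :=
    Filter.EventuallyEq.fderiv_eq (Filter.eventually_of_mem hn hX)
  simp only [leviCivita, VectorField.lieBracket, e1, e2, e3, hX q hq, hg q hq]

theorem collectiveActionLifts_iff (hS : IsOpen S) (hM : IsMonopole S (higgs L) A)
    (hA : ∀ p ∈ S, ∀ I v, connForm L α I p v = A I p v)
    (hdet : ∀ p ∈ S, (higgs L p).det ≠ 0) :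
    CollectiveActionLifts S L α ↔ IsConical S (higgs L) := by
  have hN := isOpen_totalSpace hS
  constructor
  -- The given Euler field agrees with `eulerLift` on the open set `N`, so the Euler condition
  -- passes to the explicit field.
  · rintro ⟨X, Xi, hX, hX1, hXi1, -, -⟩
    refine isConical_of_isHomotheticEuler hS hM hdet
      ((isHomotheticEuler_congr hN (fun q hq => metricG_eq hA (mem_totalSpace.1 hq)) ?_).1 hX.euler)
    exact fun q hq => eq_lift_of_canonical hA hM.symm hdet (mem_totalSpace.1 hq) (hX1 q hq)
      (hXi1 0 q hq) (hX.canonical 0 q hq)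
  · intro hC
    refine ⟨eulerLift A, rotLift (higgs L) A, ⟨?_, ?_, ?_, ?_⟩, fun _ _ => rfl, fun _ _ _ => rfl,
      fun i j q hq => lieBracket_rotLift hS hM hC (mem_totalSpace.1 hq) i j,
      fun i q hq => lieBracket_rotLift_eulerLift hS hM hC (mem_totalSpace.1 hq) i⟩
    · exact contDiffOn_liftField hM.smooth_potential fun _ => contDiffOn_const
    · exact fun i => contDiffOn_liftField hM.smooth_potential (contDiffOn_momentValue hM i)
    · exact (isHomotheticEuler_congr hN (fun q hq => metricG_eq hA (mem_totalSpace.1 hq))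
        fun _ _ => rfl).2 (isHomotheticEuler_eulerLift hS hM hdet hC)
    · exact fun i q hq v => Omega_rotLift hA hM.symm (mem_totalSpace.1 hq) i v

end
end LegendreHKC

end

theorem proposition5p1 (m : ℕ) (S : Set (LegendreHKC.Base m)) (hS : IsOpen S)
    (L : LegendreHKC.Base m → ℝ) (hL : ContDiffOn ℝ ∞ L S)
    (hconstr : LegendreHKC.LegendreConstraints S L)
    (hdet : ∀ p ∈ S, (LegendreHKC.higgs L p).det ≠ 0)
    (α : Fin m → LegendreHKC.Base m → (LegendreHKC.Base m →L[ℝ] ℝ))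
    (hα : ∀ I, ContDiffOn ℝ ∞ (α I) S)
    (hαclosed : ∀ I, LegendreHKC.IsClosedForm S (α I)) :
    (LegendreHKC.CollectiveActionLifts S L α ↔
      ∀ I J : Fin m, ∀ p ∈ S,
        LegendreHKC.dX I (LegendreHKC.dX J (LegendreHKC.coneDefect L)) p = 0 ∧
        LegendreHKC.dZ I (LegendreHKC.dX J (LegendreHKC.coneDefect L)) p = 0) ∧
    ((∀ p ∈ S, LegendreHKC.rotDeriv 0 L p = 0 ∧ LegendreHKC.scaleDeriv L p = L p) →
      LegendreHKC.CollectiveActionLifts S L α) := by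
  have key := (LegendreHKC.collectiveActionLifts_iff hS
    (LegendreHKC.isMonopole_higgs hS hL hconstr hα hαclosed)
    (fun p hp => LegendreHKC.connForm_eq hS hL hp) hdet).trans
    (LegendreHKC.isConical_higgs_iff hS hL hconstr)
  refine ⟨key, fun h => key.2 fun I J => ?_⟩
  have h0 : ∀ p ∈ S, LegendreHKC.coneDefect L p = 0 := fun p hp => by
    simp [LegendreHKC.coneDefect, h p hp]
  have h1 : ∀ p ∈ S, LegendreHKC.dX J (LegendreHKC.coneDefect L) p = 0 := fun p hp => by
    simp [LegendreHKC.dX, LegendreHKC.pd, LegendreHKC.fderiv_eq_of_eqOn hS h0 hp]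
  intro p hp
  simp [LegendreHKC.dX.eq_1 I, LegendreHKC.dZ, LegendreHKC.pd,
    LegendreHKC.fderiv_eq_of_eqOn hS h1 hp]
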